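/- Let $n\ge 2$, $\zeta\in\mathbb C$, let $p_1,\dots,p_n\in W_1^1[0,1]$ be positive on $[0,1]$ and let $q_{kl}\in L_1[0,1]$ ($1\le l\le k\le n$) be arbitrary complex-valued functions. For $\lambda\in\mathbb C\setminus\{0\}$ let $D_\lambda(t)$ be the $n\times n$ matrix with entries $$(D_\lambda)_{kl}=\begin{cases}p_k,& l=k+1,\\ (\lambda+\zeta)^np_n-q_{n1},& k=n,\ l=1,\\ -q_{kl},& k+1-n<l\le k,\\ 0&\text{otherwise,}\end{cases}$$ let $D_{\lambda,0}$ have entries $p_k$ for $l=k+1$, $\lambda^np_n$ for $(k,l)=(n,1)$ and $0$ otherwise, and put $$[A_\lambda(t)]_{kk}=\lambda\Bigl(\prod_{m=1}^np_m(t)\Bigr)^{1/n}e^{2\pi ki/n}\quad(A_\lambda\text{ diagonal}),\qquad [S_\lambda(t)]_{lk}=[A_\lambda(t)]_{kk}^{\,l-1}\prod_{m=1}^{l-1}p_m(t)^{-1}.$$ Then $S_\lambda(t)$ is invertible and $S_\lambda^{-1}D_{\lambda,0}S_\lambda=A_\lambda$ for all $\lambda\ne0$, $t\in[0,1]$. Consider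 the transformed system $$\dot y_\lambda=T_\lambda y_\lambda,\qquad T_\lambda=S_\lambda^{-1}D_\lambda S_\lambda-S_\lambda^{-1}\dot S_\lambda, \tag{$*$}$$ and, for $m\in\{1,\dots,2n\}$, the sector $\Omega_m=\{\lambda\ne0:\ \operatorname{Arg}\lambda\in(\pi(m-1)/n,\ \pi m/n)\}$, directed by $|\lambda|$. For every such $m$ the following holds. (1) There is a permutation $\tau_m$ of $1,\dots,n$ such that, with $P_k$ the diagonal orthogonal projection onto the $\tau_m(k)$-th coordinate axis (these are nonzero, pairwise orthogonal and add up to $1$), there are numbers $d_\lambda\in\mathbb C$ with $|d_\lambda|\to\infty$, functions $h_{\lambda,k}\in L_1[0,1]$ and matrix functions $V_\lambda\in L_1[0,1]$, $\lambda\in\Omega_m$, with $T_\lambda=\sum_{k=1}^n d_\lambda h_{\lambda,k}P_k+V_\lambda$ a.e. and such that: (a) for every $\varepsilon>0$ there are $\lambda_0\in\Omega_m$ and a ball of $W_1^1[0,1]$ from which every $h_{\lambda,k}$ with $|\lambda|>|\lambda_0|$ has $L_1$-distance at most $\varepsilon$; (b) for every $\varepsilon>0$ there are $\lambda_0\in\Omega_m$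 and a ball of the space of $W_1^1$ matrix functions vanishing at $0$ and $1$ from which every $V_\lambda$ with $|\lambda|>|\lambda_0|$ has $L_1$-distance (for the spectral norm) at most $\varepsilon$; (c) $|h_{\lambda,k}(t)-h_{\lambda,l}(t)|\ge1$ for all $\lambda\in\Omega_m$, almost all $t$ and all $k<l$; (d) there is $\gamma\in(0,1)$ with $\int_a^b\operatorname{Re}[d_\lambda h_{\lambda,k}-d_\lambda h_{\lambda,l}]\,dt\le-\ln\gamma$ for all $[a,b]\subseteq[0,1]$, $\lambda\in\Omega_m$ and $k<l$. (2) There is $R>0$ such that for every $k\in\{1,\dots,n\}$ and all $\lambda\in\Omega_m$ with $|\lambda|>R$ the system $(*)$ has solutions $y_{m,k,\lambda}\in W_1^1([0,1];\mathbb C^n)$, analytic in $\lambda$ on $\{\lambda\in\Omega_m:|\lambda|>R\}$ for each $t\in[0,1]$, of the form $$y_{m,k,\lambda}(t)=\Bigl(\prod_{l=1}^n p_l(t)^{\frac{n-2l+1}{2n}}\Bigr)\exp\Bigl(\int_0^t\Bigl[(\lambda+\zeta)\Bigl(\prod_{l=1}^np_l(s)\Bigr)^{1/n}e^{2\pi ki/n}-\frac1n\sum_{l=1}^nq_{ll}(s)\Bigr]ds\Bigr)\,[\xi_k+o(1)],$$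 where $\xi_k$ is the $k$-th vector of the standard basis of $\mathbb C^n$ and $o(1)\to0$ as $|\lambda|\to\infty$ in $\Omega_m$, uniformly in $t\in[0,1]$. -/

import Mathlib

open MeasureTheory Set

noncomputable section

namespace DiagMethod

/-- `f` belongs to the Sobolev space `W_1^1([0,1]; E)` (`f` being its continuous representative) and
`f'` is its derivative: `f'` is summable on `[0,1]` and `f` is a primitive of `f'` there. -/
structure HasW11Deriv {E : Type*} [NormedAddCommGroup E] [NormedSpace ℝ E]
    (f f' : ℝ → E) : Prop where
  integrable : IntegrableOn f' (Icc 0 1)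
  eq_integral : ∀ t ∈ Icc (0 : ℝ) 1, f t = f 0 + ∫ s in (0 : ℝ)..t, f' s

/-- `f` belongs to `W_1^1([0,1]; E)`. -/
def MemW11 {E : Type*} [NormedAddCommGroup E] [NormedSpace ℝ E] (f : ℝ → E) : Prop :=
  ∃ f' : ℝ → E, HasW11Deriv f f'

/-- `f` belongs to the closed ball of radius `R` about the origin of `W_1^1([0,1]; E)`. -/
def MemW11Ball {E : Type*} [NormedAddCommGroup E] [NormedSpace ℝ E] (R : ℝ) (f : ℝ → E) : Prop :=
  ∃ f' : ℝ → E, HasW11Deriv f f' ∧ ∫ t in (0 : ℝ)..1, (‖f t‖ + ‖f' t‖) ≤ R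

/-- A complete system of nonzero orthogonal projections onto pairwise orthogonal subspaces. -/
structure IsCompleteProjSystem {H : Type*} [NormedAddCommGroup H] [InnerProductSpace ℂ H]
    {m : ℕ} (P : Fin m → H →L[ℂ] H) : Prop where
  symmetricProjection : ∀ k, (P k : H →ₗ[ℂ] H).IsSymmetricProjection
  ne_zero : ∀ k, P k ≠ 0
  orthogonal : ∀ k l, k ≠ l → P k * P l = 0
  sum_eq_one : ∑ k, P k = 1

/-- The representation `A_ν = ∑_k d_ν h_{ν,k} P_k + V_ν` of a family of summable operator-functions
over a directed set `ι`, with an infinitely large numerical net `d` and with the four conditions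
under which the diagonalization method applies. -/
structure IsDiagRepresentation {H : Type*} [NormedAddCommGroup H] [InnerProductSpace ℂ H]
    {ι : Type*} [Preorder ι] [IsDirectedOrder ι] {m : ℕ}
    (A : ι → ℝ → H →L[ℂ] H) (P : Fin m → H →L[ℂ] H)
    (d : ι → ℂ) (h : ι → Fin m → ℝ → ℂ) (V : ι → ℝ → H →L[ℂ] H) : Prop where
  integrable_h : ∀ ν k, IntegrableOn (h ν k) (Icc 0 1)
  integrable_V : ∀ ν, IntegrableOn (V ν) (Icc 0 1)
  repr : ∀ ν, ∀ᵐ t ∂volume.restrict (Icc (0 : ℝ) 1),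
    A ν t = ∑ k, (d ν * h ν k t) • P k + V ν t
  d_large : ∀ R : ℝ, ∃ ν₀, ∀ ν, ν₀ < ν → R < ‖d ν‖
  /-- `h_{ν,k}` is eventually `ε`-close in `L_1` to a fixed ball of `W_1^1[0,1]`. -/
  approx_h : ∀ ε : ℝ, 0 < ε → ∃ ν₀, ∃ R : ℝ, ∀ ν, ν₀ < ν → ∀ k,
    ∃ g : ℝ → ℂ, MemW11Ball R g ∧ ∫ t in (0 : ℝ)..1, ‖h ν k t - g t‖ ≤ ε
  /-- `V_ν` is eventually `ε`-close in `L_1` to a fixed ball of the subspace of `W_1^1` of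
  operator-functions vanishing at both endpoints. -/
  approx_V : ∀ ε : ℝ, 0 < ε → ∃ ν₀, ∃ R : ℝ, ∀ ν, ν₀ < ν →
    ∃ C : ℝ → H →L[ℂ] H, MemW11Ball R C ∧ C 0 = 0 ∧ C 1 = 0 ∧
      ∫ t in (0 : ℝ)..1, ‖V ν t - C t‖ ≤ ε
  separated : ∀ ν, ∀ᵐ t ∂volume.restrict (Icc (0 : ℝ) 1), ∀ k l, k < l →
    1 ≤ ‖h ν k t - h ν l t‖
  ordered : ∃ γ : ℝ, 0 < γ ∧ γ < 1 ∧ ∀ ν, ∀ a b : ℝ, 0 ≤ a → a ≤ b → b ≤ 1 → ∀ k l, k < l →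
    ∫ t in a..b, (d ν * h ν k t - d ν * h ν l t).re ≤ -Real.log γ

/-- The family of systems `x' = A_ν x`, together with the projections `P_1, …, P_m`, satisfies the
hypotheses of the two theorems on asymptotically diagonal systems. -/
def SatisfiesDiagConditions {H : Type*} [NormedAddCommGroup H] [InnerProductSpace ℂ H]
    {ι : Type*} [Preorder ι] [IsDirectedOrder ι] {m : ℕ}
    (A : ι → ℝ → H →L[ℂ] H) (P : Fin m → H →L[ℂ] H) : Prop :=
  IsCompleteProjSystem P ∧ ∃ d h V, IsDiagRepresentation A P d h V

/-- The open sector `π(m-1)/n < Arg z < πm/n`, without the origin. -/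
def sector (n m : ℕ) : Set ℂ :=
  {z | ∃ r θ : ℝ, 0 < r ∧ Real.pi * ((m : ℝ) - 1) / n < θ ∧ θ < Real.pi * m / n ∧
    z = r * Complex.exp (θ * Complex.I)}

/-- The sector as an index set, directed by the modulus. -/
def Sector (n m : ℕ) : Type := {z : ℂ // z ∈ sector n m}

instance (n m : ℕ) : Preorder (Sector n m) := Preorder.lift (fun z => ‖z.1‖)

instance (n m : ℕ) : IsDirectedOrder (Sector n m) where
  directed a b := by
    rcases le_total ‖a.1‖ ‖b.1‖ with h | h
    · exact ⟨b, h, le_refl b⟩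
    · exact ⟨a, le_refl a, h⟩

/-! The example system. Indices `k, l ∈ {1, …, n}` of the mathematics are `k + 1`, `l + 1` with
`k l : Fin n`. -/

/-- The coefficient matrix `D_λ(t)` of the original system. -/
def Dmat {n : ℕ} (p : Fin n → ℝ → ℝ) (q : Fin n → Fin n → ℝ → ℂ) (ζ z : ℂ) (t : ℝ) :
    Matrix (Fin n) (Fin n) ℂ := fun k l =>
  if l.val = k.val + 1 then (p k t : ℂ)
  else if k.val + 1 = n ∧ l.val = 0 then (z + ζ) ^ n * (p k t : ℂ) - q k l t
  else if k.val + 1 < l.val + n ∧ l ≤ k then -q k l t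
  else 0

/-- The leading part `D_{λ,0}(t)`. -/
def Dmat0 {n : ℕ} (p : Fin n → ℝ → ℝ) (z : ℂ) (t : ℝ) : Matrix (Fin n) (Fin n) ℂ := fun k l =>
  if l.val = k.val + 1 then (p k t : ℂ)
  else if k.val + 1 = n ∧ l.val = 0 then z ^ n * (p k t : ℂ)
  else 0

/-- `(∏_m p_m(t))^{1/n}`. -/
def geomMean {n : ℕ} (p : Fin n → ℝ → ℝ) (t : ℝ) : ℝ := (∏ m, p m t) ^ (1 / (n : ℝ))

/-- `e^{2πki/n}` (with the one-based number `k + 1`). -/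
def rootU {n : ℕ} (k : Fin n) : ℂ :=
  Complex.exp (2 * Real.pi * ((k.val : ℂ) + 1) * Complex.I / n)

/-- The diagonal entries `[A_λ(t)]_{kk}`. -/
def Adiag {n : ℕ} (p : Fin n → ℝ → ℝ) (z : ℂ) (t : ℝ) (k : Fin n) : ℂ :=
  z * (geomMean p t : ℂ) * rootU k

/-- The diagonalizing matrix, `[S_λ(t)]_{lk} = [A_λ(t)]_{kk}^{l-1} ∏_{m=1}^{l-1} p_m(t)⁻¹`. -/
def Smat {n : ℕ} (p : Fin n → ℝ → ℝ) (z : ℂ) (t : ℝ) : Matrix (Fin n) (Fin n) ℂ := fun l k =>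
  Adiag p z t k ^ l.val * ∏ m ∈ Finset.univ.filter (fun m : Fin n => m < l), ((p m t : ℂ))⁻¹

/-- The entrywise derivative of `S_λ` in `t` (it exists for almost all `t ∈ [0,1]`). -/
def Sdot {n : ℕ} (p : Fin n → ℝ → ℝ) (z : ℂ) (t : ℝ) : Matrix (Fin n) (Fin n) ℂ := fun l k =>
  deriv (fun s => Smat p z s l k) t

/-- The coefficient `S_λ⁻¹ D_λ S_λ - S_λ⁻¹ S_λ'` of the transformed system, as an operator
in `ℂⁿ`. -/
def transformed {n : ℕ} (p : Fin n → ℝ → ℝ) (q : Fin n → Fin n → ℝ → ℂ) (ζ z : ℂ) (t : ℝ) :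
    EuclideanSpace ℂ (Fin n) →L[ℂ] EuclideanSpace ℂ (Fin n) :=
  Matrix.toEuclideanCLM (n := Fin n) (𝕜 := ℂ)
    ((Smat p z t)⁻¹ * Dmat p q ζ z t * Smat p z t - (Smat p z t)⁻¹ * Sdot p z t)

/-- The diagonal projection on the coordinate with number `j`. -/
def coordProj {n : ℕ} (j : Fin n) : EuclideanSpace ℂ (Fin n) →L[ℂ] EuclideanSpace ℂ (Fin n) :=
  Matrix.toEuclideanCLM (n := Fin n) (𝕜 := ℂ) (Matrix.diagonal fun l => if l = j then 1 else 0)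

/-- The scalar factor
`∏_l p_l(t)^{(n-2l+1)/(2n)} · exp ∫_0^t [(λ+ζ) (∏_l p_l)^{1/n} e^{2πki/n} - (1/n) ∑_l q_{ll}] ds`. -/
def mainFactor {n : ℕ} (p : Fin n → ℝ → ℝ) (q : Fin n → Fin n → ℝ → ℂ) (ζ z : ℂ)
    (k : Fin n) (t : ℝ) : ℂ :=
  ((∏ l : Fin n, p l t ^ (((n : ℝ) - 2 * ((l.val : ℝ) + 1) + 1) / (2 * n)) : ℝ) : ℂ) *
    Complex.exp (∫ s in (0 : ℝ)..t,
      ((z + ζ) * (geomMean p s : ℂ) * rootU k - 1 / (n : ℂ) * ∑ l, q l l s))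

end DiagMethod

end

/-!
With the weights `w_l = g^l / ∏_{m<l} p_m`, where `g` is the geometric mean of the `p_m` (see
`weight`; rows are numbered from zero), the transforming matrix factors as
`S_z = diag(z^l w_l) F` with the matrix `F` of the discrete Fourier transform (`Smat_eq`). This gives
its inverse, and its columns are eigenvectors of the leading part (`Dmat0_mul_Smat`). Conjugation
with `S_z` shows (`ae_transformed_eq`) that almost everywhere
`T_z = diag(z g ω_k) + leadPert + remPert`, where `ω_k` are the `n`-th roots of unity, `leadPert` is
summable and independent of `z`, and `remPert` is bounded by a fixed summable function times a
number tending to zero. The weights are exponentials of `W_1^1` functions, so the exceptional set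
does not depend on `z`.

*The diagonal representation.* One takes `d_z` and `h_{z,k}` proportional to `z` and `ω_{τ(k)} g`,
and `V_z = leadPert + remPert`; `V_z` is close in `L_1` to a smooth approximation of `leadPert`
vanishing at both endpoints. The order of the real parts `Re z ω_k` is constant in a sector
(`re_nonpos_of_mem_sector`): their differences are products of two sines, one independent of `z` and
the other one without zeros in the sector. The permutation `τ` sorts these real parts.

*The solutions.* With the scalar factor split off, the vector `u` of amplitudes of the `k`-th solution
satisfies `u_j' = (z + ζ)(ω_j - ω_k) g u_j + ∑_l N_{jl} u_l`: the diagonal of `leadPert`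
(`leadPert_diag`) accounts for the shift `ζ` and for the factors in front of `[ξ_k + o(1)]`, and `N`
consists of the off-diagonal part of `leadPert` and of `remPert`. Integrating the `j`-th equation from
the endpoint at which its kernel stays bounded, one obtains `u = e_k + K u` with `K` bounded
uniformly in `z`. In general `K` is not small, but it is small on functions that satisfy a system
of the same shape (`OscillatingSystem.eventually_norm_K_le`): the `l`-th component of such a function
oscillates at a rate different from that of the `j`-th kernel, `j ≠ l`, and one integrates by parts
after approximating the `L_1` coefficients by smooth ones. Constants and the values of `K` are such
functions, so the terms of the Neumann series `∑ K^i e_k` decay geometrically with an arbitrarily small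
ratio. Its sum solves the equation, is close to `e_k` uniformly in `t`, and is holomorphic in `z` as
a uniform limit of holomorphic functions (`OscillatingSystem.exists_amplitude`).
-/

noncomputable section

namespace DiagMethod

/-! ### Calculus in `W_1^1[0,1]` -/

open AbsolutelyContinuousOnInterval in
/-- Composition with a function that is Lipschitz on the range preserves absolute continuity. -/
lemma _root_.LipschitzOnWith.comp_absolutelyContinuousOnInterval
    {X Y : Type*} [PseudoMetricSpace X] [PseudoMetricSpace Y] {φ : X → Y} {K : NNReal} {f : ℝ → X}
    {a b : ℝ} (hφ : LipschitzOnWith K φ (f '' uIcc a b))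
    (hf : AbsolutelyContinuousOnInterval f a b) :
    AbsolutelyContinuousOnInterval (fun t => φ (f t)) a b := by
  rw [absolutelyContinuousOnInterval_iff] at hf ⊢
  intro ε hε
  obtain ⟨δ, hδ, H⟩ := hf (ε / (K + 1)) (by positivity)
  refine ⟨δ, hδ, fun E hE hlt => ?_⟩
  have h1 : ∑ i ∈ Finset.range E.1, dist (φ (f (E.2 i).1)) (φ (f (E.2 i).2)) ≤
      K * ∑ i ∈ Finset.range E.1, dist (f (E.2 i).1) (f (E.2 i).2) := by
    rw [Finset.mul_sum]
    refine Finset.sum_le_sum fun i hi => ?_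
    exact hφ.dist_le_mul _ (mem_image_of_mem _ (hE.1 i hi).1) _ (mem_image_of_mem _ (hE.1 i hi).2)
  have h2 := H E hE hlt
  rw [lt_div_iff₀ (by positivity)] at h2
  have h3 : 0 ≤ ∑ i ∈ Finset.range E.1, dist (f (E.2 i).1) (f (E.2 i).2) :=
    Finset.sum_nonneg fun _ _ => dist_nonneg
  nlinarith

lemma _root_.AbsolutelyContinuousOnInterval.congr {X : Type*} [PseudoMetricSpace X] {f h : ℝ → X}
    {a b : ℝ} (hf : AbsolutelyContinuousOnInterval f a b) (hfh : ∀ t ∈ uIcc a b, f t = h t) :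
    AbsolutelyContinuousOnInterval h a b := by
  rw [absolutelyContinuousOnInterval_iff] at hf ⊢
  intro ε hε
  obtain ⟨δ, hδ, H⟩ := hf ε hε
  refine ⟨δ, hδ, fun E hE hlt => ?_⟩
  convert H E hE hlt using 1
  refine Finset.sum_congr rfl fun i hi => ?_
  rw [hfh _ (hE.1 i hi).1, hfh _ (hE.1 i hi).2]

lemma absolutelyContinuousOnInterval_const {X : Type*} [PseudoMetricSpace X] (c : X) (a b : ℝ) :
    AbsolutelyContinuousOnInterval (fun _ => c) a b :=
  ((LipschitzWith.const c).lipschitzOnWith (s := uIcc a b)).absolutelyContinuousOnInterval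

lemma intervalIntegrable_of_integrableOn_Icc {E : Type*} [NormedAddCommGroup E] {f : ℝ → E}
    (hf : IntegrableOn f (Icc 0 1)) {a b : ℝ} (ha : a ∈ Icc (0 : ℝ) 1) (hb : b ∈ Icc (0 : ℝ) 1) :
    IntervalIntegrable f volume a b := by
  rw [intervalIntegrable_iff]
  exact hf.mono_set (uIoc_subset_uIcc.trans (uIcc_subset_Icc ha hb))

/-- Primitives of summable complex functions are absolutely continuous. -/
lemma absolutelyContinuousOnInterval_primitive {f : ℝ → ℂ} (hf : IntegrableOn f (Icc 0 1)) :
    AbsolutelyContinuousOnInterval (fun t => ∫ s in (0 : ℝ)..t, f s) 0 1 := by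
  have h01 : IntervalIntegrable f volume 0 1 :=
    intervalIntegrable_of_integrableOn_Icc hf (by simp) (by simp)
  have hre : IntervalIntegrable (fun s => (f s).re) volume 0 1 := ⟨h01.1.re, h01.2.re⟩
  have him : IntervalIntegrable (fun s => (f s).im) volume 0 1 := ⟨h01.1.im, h01.2.im⟩
  have h1 := hre.absolutelyContinuousOnInterval_intervalIntegral (c := 0) (by simp)
  have h2 := him.absolutelyContinuousOnInterval_intervalIntegral (c := 0) (by simp)
  have h3 := (h1.smul (absolutelyContinuousOnInterval_const (1 : ℂ) 0 1)).add
    (h2.smul (absolutelyContinuousOnInterval_const Complex.I 0 1))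
  refine h3.congr fun t ht => ?_
  rw [uIcc_of_le zero_le_one] at ht
  have hft : IntervalIntegrable f volume 0 t :=
    intervalIntegrable_of_integrableOn_Icc hf (by simp) ht
  have e1 : ∫ s in (0 : ℝ)..t, (f s).re = (∫ s in (0 : ℝ)..t, f s).re :=
    Complex.reCLM.intervalIntegral_comp_comm hft
  have e2 : ∫ s in (0 : ℝ)..t, (f s).im = (∫ s in (0 : ℝ)..t, f s).im :=
    Complex.imCLM.intervalIntegral_comp_comm hft
  simp only [Pi.add_apply, Pi.smul_apply', Complex.real_smul, mul_one, e1, e2]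
  exact Complex.re_add_im _

namespace HasW11Deriv

lemma absolutelyContinuousOnInterval {f f' : ℝ → ℂ} (hf : HasW11Deriv f f') :
    AbsolutelyContinuousOnInterval f 0 1 := by
  refine ((absolutelyContinuousOnInterval_const (f 0) 0 1).add
    (absolutelyContinuousOnInterval_primitive hf.integrable)).congr fun t ht => ?_
  rw [uIcc_of_le zero_le_one] at ht
  exact (hf.eq_integral t ht).symm

lemma continuousOn {E : Type*} [NormedAddCommGroup E] [NormedSpace ℝ E] {f f' : ℝ → E}
    (hf : HasW11Deriv f f') : ContinuousOn f (Icc 0 1) := by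
  have h := (intervalIntegral.continuousOn_primitive_interval
    (μ := volume) (a := 0) (b := 1) (f := f') (by simpa using hf.integrable))
  rw [uIcc_of_le zero_le_one] at h
  exact (continuousOn_const.add h).congr fun t ht => hf.eq_integral t ht

lemma ae_hasDerivAt {E : Type*} [NormedAddCommGroup E] [NormedSpace ℝ E] [CompleteSpace E]
    {f f' : ℝ → E} (hf : HasW11Deriv f f') :
    ∀ᵐ t, t ∈ Icc (0 : ℝ) 1 → t ∈ Ioo (0 : ℝ) 1 ∧ HasDerivAt f (f' t) t := by
  have h01 : IntervalIntegrable f' volume 0 1 :=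
    intervalIntegrable_of_integrableOn_Icc hf.integrable (by simp) (by simp)
  have h₁ : ∀ᵐ x : ℝ, x ≠ 0 := by simp [ae_iff, measure_singleton]
  have h₂ : ∀ᵐ x : ℝ, x ≠ 1 := by simp [ae_iff, measure_singleton]
  filter_upwards [h01.ae_hasDerivAt_integral, h₁, h₂] with t ht h0 h1 hmem
  have hIoo : t ∈ Ioo (0 : ℝ) 1 :=
    ⟨lt_of_le_of_ne hmem.1 (Ne.symm h0), lt_of_le_of_ne hmem.2 h1⟩
  refine ⟨hIoo, ?_⟩
  have h3 := (ht (by rwa [uIcc_of_le zero_le_one]) 0 (by simp)).const_add (f 0)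
  refine h3.congr_of_eventuallyEq ?_
  filter_upwards [Ioo_mem_nhds hIoo.1 hIoo.2] with s hs
  exact hf.eq_integral s ⟨hs.1.le, hs.2.le⟩

/-- An absolutely continuous function is a primitive of its almost everywhere derivative. -/
lemma of_absolutelyContinuous {f f' : ℝ → ℂ} (hf : AbsolutelyContinuousOnInterval f 0 1)
    (hf' : IntegrableOn f' (Icc 0 1))
    (hd : ∀ᵐ t, t ∈ Icc (0 : ℝ) 1 → HasDerivAt f (f' t) t) : HasW11Deriv f f' := by
  refine ⟨hf', ?_⟩
  have h01 : IntervalIntegrable f' volume 0 1 :=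
    intervalIntegrable_of_integrableOn_Icc hf' (by simp) (by simp)
  obtain ⟨C, hC⟩ := (hf.sub (absolutelyContinuousOnInterval_primitive hf')
    ).const_of_ae_hasDerivAt_zero (by
      filter_upwards [hd, h01.ae_hasDerivAt_integral] with t h1 h2 ht
      have h3 := (h1 (by rwa [uIcc_of_le zero_le_one] at ht)).sub (h2 ht 0 (by simp))
      rwa [sub_self] at h3)
  rw [uIcc_of_le zero_le_one] at hC
  intro t ht
  have h0 := hC 0 (by simp)
  have h1 := hC t ht
  simp only [Pi.sub_apply, intervalIntegral.integral_same, sub_zero] at h0 h1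
  rw [h0, ← h1]; ring

lemma congr {E : Type*} [NormedAddCommGroup E] [NormedSpace ℝ E] {f f' h h' : ℝ → E}
    (hf : HasW11Deriv f f') (h1 : ∀ t ∈ Icc (0 : ℝ) 1, f t = h t)
    (h2 : ∀ᵐ t, t ∈ Icc (0 : ℝ) 1 → f' t = h' t) : HasW11Deriv h h' := by
  have h2' : f' =ᵐ[volume.restrict (Icc 0 1)] h' :=
    (ae_restrict_iff' measurableSet_Icc).2 h2
  refine ⟨hf.integrable.congr h2', fun t ht => ?_⟩
  rw [← h1 t ht, ← h1 0 (by simp), hf.eq_integral t ht]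
  congr 1
  refine intervalIntegral.integral_congr_ae ?_
  filter_upwards [h2] with s hs hmem
  rw [uIoc_of_le ht.1] at hmem
  exact hs ⟨hmem.1.le, hmem.2.trans ht.2⟩

lemma add {E : Type*} [NormedAddCommGroup E] [NormedSpace ℝ E] {f f' h h' : ℝ → E}
    (hf : HasW11Deriv f f') (hh : HasW11Deriv h h') :
    HasW11Deriv (fun t => f t + h t) (fun t => f' t + h' t) := by
  refine ⟨hf.integrable.add hh.integrable, fun t ht => ?_⟩
  rw [intervalIntegral.integral_add
    (intervalIntegrable_of_integrableOn_Icc hf.integrable (by simp) ht)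
    (intervalIntegrable_of_integrableOn_Icc hh.integrable (by simp) ht),
    hf.eq_integral t ht, hh.eq_integral t ht]
  abel

lemma const {E : Type*} [NormedAddCommGroup E] [NormedSpace ℝ E] (c : E) :
    HasW11Deriv (fun _ => c) (fun _ => 0) :=
  ⟨by simp, fun t _ => by simp⟩

lemma sum {E : Type*} [NormedAddCommGroup E] [NormedSpace ℝ E] {ι : Type*} (s : Finset ι)
    {f f' : ι → ℝ → E} (hf : ∀ i ∈ s, HasW11Deriv (f i) (f' i)) :
    HasW11Deriv (fun t => ∑ i ∈ s, f i t) (fun t => ∑ i ∈ s, f' i t) := by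
  classical
  induction s using Finset.induction_on with
  | empty => simpa using const (0 : E)
  | insert a s ha ih =>
    simp only [Finset.sum_insert ha]
    exact (hf a (by simp)).add (ih fun i hi => hf i (by simp [hi]))

/-- Bounded real-linear maps act on `W_1^1`. -/
lemma clm_comp {E F : Type*} [NormedAddCommGroup E] [NormedSpace ℝ E] [CompleteSpace E]
    [NormedAddCommGroup F] [NormedSpace ℝ F] [CompleteSpace F] (L : E →L[ℝ] F) {f f' : ℝ → E}
    (hf : HasW11Deriv f f') : HasW11Deriv (fun t => L (f t)) (fun t => L (f' t)) := by
  refine ⟨L.integrable_comp hf.integrable, fun t ht => ?_⟩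
  rw [L.intervalIntegral_comp_comm
    (intervalIntegrable_of_integrableOn_Icc hf.integrable (by simp) ht), ← map_add,
    ← hf.eq_integral t ht]

lemma ofReal {f f' : ℝ → ℝ} (hf : HasW11Deriv f f') :
    HasW11Deriv (fun t => (f t : ℂ)) (fun t => (f' t : ℂ)) :=
  hf.clm_comp Complex.ofRealCLM

lemma const_mul {f f' : ℝ → ℂ} (c : ℂ) (hf : HasW11Deriv f f') :
    HasW11Deriv (fun t => c * f t) (fun t => c * f' t) :=
  hf.clm_comp ((ContinuousLinearMap.mul ℝ ℂ) c)

/-- Product rule. -/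
lemma mul {f f' h h' : ℝ → ℂ} (hf : HasW11Deriv f f') (hh : HasW11Deriv h h') :
    HasW11Deriv (fun t => f t * h t) (fun t => f' t * h t + f t * h' t) := by
  refine of_absolutelyContinuous
    (hf.absolutelyContinuousOnInterval.smul hh.absolutelyContinuousOnInterval) ?_ ?_
  · exact (hf.integrable.mul_continuousOn hh.continuousOn isCompact_Icc).add
      (hh.integrable.continuousOn_mul hf.continuousOn isCompact_Icc)
  · filter_upwards [hf.ae_hasDerivAt, hh.ae_hasDerivAt] with t h1 h2 ht
    exact (h1 ht).2.mul (h2 ht).2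

/-- Chain rule for the exponential function. -/
lemma cexp {f f' : ℝ → ℂ} (hf : HasW11Deriv f f') :
    HasW11Deriv (fun t => Complex.exp (f t)) (fun t => Complex.exp (f t) * f' t) := by
  obtain ⟨C, hC⟩ := isCompact_Icc.exists_bound_of_continuousOn hf.continuousOn
  obtain ⟨K, hK⟩ := (Complex.contDiff_exp (𝕜 := ℝ) (n := 1)).contDiffOn.exists_lipschitzOnWith
    (by decide) (convex_closedBall (0 : ℂ) C) (isCompact_closedBall _ _)
  refine of_absolutelyContinuous
    ((hK.mono ?_).comp_absolutelyContinuousOnInterval hf.absolutelyContinuousOnInterval) ?_ ?_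
  · rintro _ ⟨t, ht, rfl⟩
    rw [uIcc_of_le zero_le_one] at ht
    simpa using hC t ht
  · exact hf.integrable.continuousOn_mul (Complex.continuous_exp.comp_continuousOn hf.continuousOn)
      isCompact_Icc
  · filter_upwards [hf.ae_hasDerivAt] with t h1 ht
    exact (h1 ht).2.cexp

lemma integral_eq_sub {f f' : ℝ → ℂ} (hf : HasW11Deriv f f') {a b : ℝ} (ha : a ∈ Icc (0 : ℝ) 1)
    (hb : b ∈ Icc (0 : ℝ) 1) : ∫ s in a..b, f' s = f b - f a := by
  rw [hf.eq_integral b hb, hf.eq_integral a ha, add_sub_add_left_eq_sub,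
    intervalIntegral.integral_interval_sub_left
      (intervalIntegrable_of_integrableOn_Icc hf.integrable (by simp) hb)
      (intervalIntegrable_of_integrableOn_Icc hf.integrable (by simp) ha)]

/-- The primitive of a summable function with an arbitrary initial point in `[0,1]`. -/
lemma primitive {f : ℝ → ℂ} (hf : IntegrableOn f (Icc 0 1)) {a : ℝ} (ha : a ∈ Icc (0 : ℝ) 1) :
    HasW11Deriv (fun t => ∫ s in a..t, f s) f := by
  refine ⟨hf, fun t ht => ?_⟩
  rw [intervalIntegral.integral_add_adjacent_intervals
    (intervalIntegrable_of_integrableOn_Icc hf ha (by simp))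
    (intervalIntegrable_of_integrableOn_Icc hf (by simp) ht)]

lemma of_contDiff {f : ℝ → ℂ} (hf : ContDiff ℝ 1 f) : HasW11Deriv f (deriv f) := by
  have hc : Continuous (deriv f) := hf.continuous_deriv le_rfl
  refine ⟨hc.continuousOn.integrableOn_Icc, fun t _ => ?_⟩
  rw [intervalIntegral.integral_deriv_eq_sub
    (fun x _ => (hf.differentiable one_ne_zero).differentiableAt) (hc.intervalIntegrable _ _)]
  ring

/-- The logarithm of a positive `W_1^1` function is a `W_1^1` function. -/
lemma log {p p' : ℝ → ℝ} (hp : HasW11Deriv p p') (hpos : ∀ t ∈ Icc (0 : ℝ) 1, 0 < p t) :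
    HasW11Deriv (fun t => Real.log (p t)) (fun t => p' t / p t) := by
  have hint : IntegrableOn (fun t => p' t / p t) (Icc 0 1) := by
    simp only [div_eq_mul_inv]
    exact hp.integrable.mul_continuousOn
      (hp.continuousOn.inv₀ fun t ht => (hpos t ht).ne') isCompact_Icc
  have hL : HasW11Deriv (fun t => ∫ s in (0 : ℝ)..t, p' s / p s) (fun t => p' t / p t) :=
    ⟨hint, fun t _ => by simp⟩
  -- `p · exp(-∫ p'/p)` has zero derivative, hence is constant.
  have hprod := hp.ofReal.mul (hL.ofReal.const_mul (-1)).cexp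
  have hconst := fun (t : ℝ) (ht : t ∈ Icc (0 : ℝ) 1) =>
    (hprod.congr (h' := fun _ => 0) (fun _ _ => rfl) (by
      refine Filter.Eventually.of_forall fun t ht => ?_
      have : (p t : ℂ) ≠ 0 := by exact_mod_cast (hpos t ht).ne'
      push_cast
      field_simp
      ring)).eq_integral t ht
  refine ⟨hint, fun t ht => ?_⟩
  have h1 := hconst t ht
  simp only [intervalIntegral.integral_zero, add_zero, intervalIntegral.integral_same,
    Complex.ofReal_zero, mul_zero, Complex.exp_zero, mul_one] at h1
  have h2 : p t * Real.exp (-∫ s in (0 : ℝ)..t, p' s / p s) = p 0 := by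
    have := congrArg Complex.re h1
    rw [neg_one_mul, ← Complex.ofReal_neg, ← Complex.ofReal_exp, ← Complex.ofReal_mul,
      Complex.ofReal_re, Complex.ofReal_re] at this
    exact this
  have h3 : Real.log (p 0) = Real.log (p t) + -∫ s in (0 : ℝ)..t, p' s / p s := by
    rw [← h2, Real.log_mul (hpos t ht).ne' (Real.exp_pos _).ne', Real.log_exp]
  rw [h3]; ring

end HasW11Deriv

/-- Smooth functions vanishing at both endpoints are dense in `L_1[0,1]`. -/
lemma exists_contDiff_integral_sub_le {f : ℝ → ℂ} (hf : IntegrableOn f (Icc 0 1)) {ε : ℝ}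
    (hε : 0 < ε) : ∃ χ : ℝ → ℂ, ContDiff ℝ 1 χ ∧ χ 0 = 0 ∧ χ 1 = 0 ∧
      ∫ t in (0 : ℝ)..1, ‖f t - χ t‖ ≤ ε := by
  obtain ⟨g, -, hg, hle⟩ := (memLp_one_iff_integrable.2 hf).exist_eLpNorm_sub_le
    (by simp) le_rfl (half_pos hε)
  have hgc : ContDiff ℝ 1 g := hg.of_le (by exact_mod_cast le_top)
  have hgi : IntegrableOn g (Icc 0 1) := hgc.continuous.continuousOn.integrableOn_Icc
  have hfg : IntegrableOn (fun t => f t - g t) (Icc 0 1) := hf.sub hgi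
  have hle' : ∫ t in (0 : ℝ)..1, ‖f t - g t‖ ≤ ε / 2 := by
    rw [intervalIntegral.integral_of_le zero_le_one, ← integral_Icc_eq_integral_Ioc,
      integral_norm_eq_lintegral_enorm hfg.aestronglyMeasurable]
    rw [eLpNorm_one_eq_lintegral_enorm] at hle
    exact ENNReal.toReal_le_of_le_ofReal (half_pos hε).le hle
  obtain ⟨N, hN⟩ := exists_nat_gt ((‖g 0‖ + ‖g 1‖) / (ε / 2))
  -- The boundary values are removed by the correction `g(0)(1-t)^(N+1) + g(1)t^(N+1)`, which is
  -- small in `L_1`.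
  let c : ℝ → ℂ := fun t => g 0 * ((1 - t : ℝ) : ℂ) ^ (N + 1) + g 1 * ((t : ℝ) : ℂ) ^ (N + 1)
  have hcd : ContDiff ℝ 1 c := by
    refine (contDiff_const.mul (ContDiff.pow ?_ _)).add (contDiff_const.mul (ContDiff.pow ?_ _))
    · exact Complex.ofRealCLM.contDiff.comp (contDiff_const.sub contDiff_id)
    · exact Complex.ofRealCLM.contDiff
  have hci : IntegrableOn c (Icc 0 1) := hcd.continuous.continuousOn.integrableOn_Icc
  have hcb : ∫ t in (0 : ℝ)..1, ‖c t‖ ≤ ε / 2 := by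
    have hb : ∫ t in (0 : ℝ)..1, ‖c t‖ ≤
        ∫ t in (0 : ℝ)..1, (‖g 0‖ * (1 - t) ^ (N + 1) + ‖g 1‖ * t ^ (N + 1)) := by
      refine intervalIntegral.integral_mono_on zero_le_one
        (hcd.continuous.norm.intervalIntegrable _ _)
        (Continuous.intervalIntegrable (by fun_prop) _ _) fun t ht => ?_
      refine (norm_add_le _ _).trans (le_of_eq ?_)
      simp only [norm_mul, norm_pow, Complex.norm_real, Real.norm_eq_abs]
      rw [abs_of_nonneg (sub_nonneg.2 ht.2), abs_of_nonneg ht.1]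
    refine hb.trans ?_
    rw [intervalIntegral.integral_add (Continuous.intervalIntegrable (by fun_prop) _ _)
      (Continuous.intervalIntegrable (by fun_prop) _ _), intervalIntegral.integral_const_mul,
      intervalIntegral.integral_const_mul,
      intervalIntegral.integral_comp_sub_left (fun t : ℝ => t ^ (N + 1)) 1]
    simp only [sub_self, sub_zero, integral_pow, one_pow, ne_eq, Nat.add_eq_zero_iff, one_ne_zero,
      and_false, not_false_eq_true, zero_pow]
    rw [div_lt_iff₀ (half_pos hε)] at hN
    have hpos : (0 : ℝ) < ((N + 1 : ℕ) : ℝ) + 1 := by positivity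
    rw [← add_mul, mul_one_div, div_le_iff₀ hpos]
    push_cast
    nlinarith
  refine ⟨fun t => g t - c t, hgc.sub hcd, by simp [c], by simp [c], ?_⟩
  calc ∫ t in (0 : ℝ)..1, ‖f t - (g t - c t)‖
      ≤ ∫ t in (0 : ℝ)..1, (‖f t - g t‖ + ‖c t‖) := by
        refine intervalIntegral.integral_mono_on zero_le_one ?_ ?_ fun t _ => ?_
        · exact (intervalIntegrable_of_integrableOn_Icc (hf.sub (hgi.sub hci)) (by simp)
            (by simp)).norm
        · exact (intervalIntegrable_of_integrableOn_Icc hfg (by simp) (by simp)).norm.add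
            (intervalIntegrable_of_integrableOn_Icc hci (by simp) (by simp)).norm
        · rw [← sub_add]; exact norm_add_le _ _
    _ ≤ ε := by
        rw [intervalIntegral.integral_add
          (intervalIntegrable_of_integrableOn_Icc hfg (by simp) (by simp)).norm
          (intervalIntegrable_of_integrableOn_Icc hci (by simp) (by simp)).norm]
        linarith

/-! ### Volterra operators with oscillating kernels -/

/-- The solution `e^{Ψ(t)} ∫_a^t e^{-Ψ(s)} φ(s) ds` of `v' = Ψ' v + φ` that vanishes at `a`. -/
def volterra (Ψ : ℝ → ℂ) (a : ℝ) (φ : ℝ → ℂ) (t : ℝ) : ℂ :=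
  Complex.exp (Ψ t) * ∫ s in a..t, Complex.exp (-Ψ s) * φ s

lemma continuousOn_exp_neg {Ψ : ℝ → ℂ} (hΨ : ContinuousOn Ψ (Icc 0 1)) :
    ContinuousOn (fun s => Complex.exp (-Ψ s)) (Icc 0 1) :=
  Complex.continuous_exp.comp_continuousOn hΨ.neg

lemma integrableOn_exp_neg_mul {Ψ φ : ℝ → ℂ} (hΨ : ContinuousOn Ψ (Icc 0 1))
    (hφ : IntegrableOn φ (Icc 0 1)) :
    IntegrableOn (fun s => Complex.exp (-Ψ s) * φ s) (Icc 0 1) :=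
  hφ.continuousOn_mul (continuousOn_exp_neg hΨ) isCompact_Icc

lemma hasW11Deriv_volterra {Ψ ψ φ : ℝ → ℂ} (hΨ : HasW11Deriv Ψ ψ)
    (hφ : IntegrableOn φ (Icc 0 1)) {a : ℝ} (ha : a ∈ Icc (0 : ℝ) 1) :
    HasW11Deriv (volterra Ψ a φ) (fun t => ψ t * volterra Ψ a φ t + φ t) := by
  refine (hΨ.cexp.mul (HasW11Deriv.primitive
    (integrableOn_exp_neg_mul hΨ.continuousOn hφ) ha)).congr (fun _ _ => rfl)
    (Filter.Eventually.of_forall fun t _ => ?_)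
  simp only [volterra, ← mul_assoc, ← Complex.exp_add, add_neg_cancel, Complex.exp_zero]
  ring

/-- `M` bounds the kernel `e^{Ψ(t) - Ψ(s)}` for `s` between the initial point `a` and `t`. -/
def KernelBound (Ψ : ℝ → ℂ) (a M : ℝ) : Prop :=
  ∀ t ∈ Icc (0 : ℝ) 1, ∀ s ∈ uIcc a t, ‖Complex.exp (Ψ t) * Complex.exp (-Ψ s)‖ ≤ M

lemma norm_volterra_le {Ψ φ : ℝ → ℂ} {a M : ℝ} (hΨ : ContinuousOn Ψ (Icc 0 1))
    (hφ : IntegrableOn φ (Icc 0 1)) (ha : a ∈ Icc (0 : ℝ) 1) (hM : KernelBound Ψ a M)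
    {t : ℝ} (ht : t ∈ Icc (0 : ℝ) 1) :
    ‖volterra Ψ a φ t‖ ≤ M * ∫ s in (0 : ℝ)..1, ‖φ s‖ := by
  have hM0 : 0 ≤ M := (norm_nonneg _).trans (hM t ht t right_mem_uIcc)
  have hsub : uIoc a t ⊆ Icc 0 1 := uIoc_subset_uIcc.trans (uIcc_subset_Icc ha ht)
  rw [volterra, ← intervalIntegral.integral_const_mul]
  refine intervalIntegral.norm_integral_le_integral_norm_uIoc.trans ?_
  rw [intervalIntegral.integral_of_le zero_le_one, ← integral_Icc_eq_integral_Ioc,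
    ← integral_const_mul]
  refine (setIntegral_mono_on
    (((integrableOn_exp_neg_mul hΨ hφ).mono_set hsub).const_mul _).norm
    ((hφ.mono_set hsub).norm.const_mul M) measurableSet_uIoc fun s hs => ?_).trans
    (setIntegral_mono_set (hφ.norm.const_mul M)
      (Filter.Eventually.of_forall fun s => by positivity) hsub.eventuallyLE)
  rw [← mul_assoc, norm_mul]
  gcongr
  exact hM t ht s (uIoc_subset_uIcc hs)

lemma volterra_add {Ψ φ₁ φ₂ : ℝ → ℂ} {a : ℝ} (hΨ : ContinuousOn Ψ (Icc 0 1))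
    (h₁ : IntegrableOn φ₁ (Icc 0 1)) (h₂ : IntegrableOn φ₂ (Icc 0 1)) (ha : a ∈ Icc (0 : ℝ) 1)
    {t : ℝ} (ht : t ∈ Icc (0 : ℝ) 1) :
    volterra Ψ a (fun s => φ₁ s + φ₂ s) t = volterra Ψ a φ₁ t + volterra Ψ a φ₂ t := by
  simp only [volterra, mul_add]
  rw [intervalIntegral.integral_add
    (intervalIntegrable_of_integrableOn_Icc (integrableOn_exp_neg_mul hΨ h₁) ha ht)
    (intervalIntegrable_of_integrableOn_Icc (integrableOn_exp_neg_mul hΨ h₂) ha ht), mul_add]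

lemma volterra_sum {ι : Type*} (S : Finset ι) {Ψ : ℝ → ℂ} {φ : ι → ℝ → ℂ} {a : ℝ}
    (hΨ : ContinuousOn Ψ (Icc 0 1)) (h : ∀ i ∈ S, IntegrableOn (φ i) (Icc 0 1))
    (ha : a ∈ Icc (0 : ℝ) 1) {t : ℝ} (ht : t ∈ Icc (0 : ℝ) 1) :
    volterra Ψ a (fun s => ∑ i ∈ S, φ i s) t = ∑ i ∈ S, volterra Ψ a (φ i) t := by
  simp only [volterra, Finset.mul_sum]
  rw [intervalIntegral.integral_finsetSum fun i hi =>
    intervalIntegrable_of_integrableOn_Icc (integrableOn_exp_neg_mul hΨ (h i hi)) ha ht,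
    Finset.mul_sum]

/-- Integration by parts against a kernel oscillating at a rate different from that of `w`:
if `w' = ν w + Φ` with `ν - Ψ' = c g`, the Volterra operator maps `g χ w` to a function of
size `O(1/|c|)`. -/
lemma norm_mul_norm_volterra_le {Ψ ψ ν g χ χ' w Φ : ℝ → ℂ} {a M X b : ℝ} {c : ℂ}
    (hΨ : HasW11Deriv Ψ ψ) (ha : a ∈ Icc (0 : ℝ) 1) (hM : KernelBound Ψ a M) (hM1 : 1 ≤ M)
    (hχ : HasW11Deriv χ χ') (hχX : ∀ t ∈ Icc (0 : ℝ) 1, ‖χ t‖ ≤ X)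
    (hχ'X : ∫ t in (0 : ℝ)..1, ‖χ' t‖ ≤ X) (hΦ : IntegrableOn Φ (Icc 0 1))
    (hw : HasW11Deriv w (fun t => ν t * w t + Φ t)) (hwb : ∀ t ∈ Icc (0 : ℝ) 1, ‖w t‖ ≤ b)
    (hΦb : ∫ t in (0 : ℝ)..1, ‖Φ t‖ ≤ b) (hg : ContinuousOn g (Icc 0 1))
    (hc : ∀ t ∈ Icc (0 : ℝ) 1, ν t - ψ t = c * g t) {t : ℝ} (ht : t ∈ Icc (0 : ℝ) 1) :
    ‖c‖ * ‖volterra Ψ a (fun s => g s * χ s * w s) t‖ ≤ 4 * M * X * b := by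
  have hX : 0 ≤ X := (norm_nonneg _).trans (hχX 0 (by simp))
  have hb : 0 ≤ b := (norm_nonneg _).trans (hwb 0 (by simp))
  have hχw : IntegrableOn (fun s => χ' s * w s) (Icc 0 1) :=
    hχ.integrable.mul_continuousOn hw.continuousOn isCompact_Icc
  have hχΦ : IntegrableOn (fun s => χ s * Φ s) (Icc 0 1) :=
    hΦ.continuousOn_mul hχ.continuousOn isCompact_Icc
  have hsum : IntegrableOn (fun s => χ' s * w s + χ s * Φ s) (Icc 0 1) := hχw.add hχΦ
  have hgχw : IntegrableOn (fun s => g s * χ s * w s) (Icc 0 1) :=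
    ((hg.mul hχ.continuousOn).mul hw.continuousOn).integrableOn_Icc
  have hD := (((hΨ.const_mul (-1)).cexp).mul (hχ.mul hw)).congr
    (h := fun s => Complex.exp (-Ψ s) * (χ s * w s))
    (h' := fun s => c * (Complex.exp (-Ψ s) * (g s * χ s * w s)) +
      Complex.exp (-Ψ s) * (χ' s * w s + χ s * Φ s))
    (fun s _ => by simp) (Filter.Eventually.of_forall fun s hs => by
      have := hc s hs
      rw [sub_eq_iff_eq_add] at this
      simp only [this]
      ring_nf)
  have key := hD.integral_eq_sub ha ht
  rw [intervalIntegral.integral_add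
    (intervalIntegrable_of_integrableOn_Icc
      ((integrableOn_exp_neg_mul hΨ.continuousOn hgχw).const_mul c) ha ht)
    (intervalIntegrable_of_integrableOn_Icc
      (integrableOn_exp_neg_mul hΨ.continuousOn hsum) ha ht),
    intervalIntegral.integral_const_mul] at key
  have hid : c * volterra Ψ a (fun s => g s * χ s * w s) t =
      χ t * w t - Complex.exp (Ψ t) * Complex.exp (-Ψ a) * (χ a * w a) -
        volterra Ψ a (fun s => χ' s * w s + χ s * Φ s) t := by
    have h1 : Complex.exp (Ψ t) * Complex.exp (-Ψ t) = 1 := by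
      rw [← Complex.exp_add, add_neg_cancel, Complex.exp_zero]
    simp only [volterra]
    linear_combination Complex.exp (Ψ t) * key + χ t * w t * h1
  have hvol : ‖volterra Ψ a (fun s => χ' s * w s + χ s * Φ s) t‖ ≤ M * (2 * (X * b)) := by
    refine (norm_volterra_le hΨ.continuousOn hsum ha hM ht).trans ?_
    refine mul_le_mul_of_nonneg_left ?_ (by linarith)
    have hχ'n := (intervalIntegrable_of_integrableOn_Icc hχ.integrable
      (left_mem_Icc.2 zero_le_one) (right_mem_Icc.2 zero_le_one)).norm
    have hΦn := (intervalIntegrable_of_integrableOn_Icc hΦ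
      (left_mem_Icc.2 zero_le_one) (right_mem_Icc.2 zero_le_one)).norm
    calc ∫ s in (0 : ℝ)..1, ‖χ' s * w s + χ s * Φ s‖
        ≤ ∫ s in (0 : ℝ)..1, (‖χ' s‖ * b + X * ‖Φ s‖) := by
          refine intervalIntegral.integral_mono_on zero_le_one
            (intervalIntegrable_of_integrableOn_Icc hsum (by simp) (by simp)).norm
            ((hχ'n.mul_const _).add (hΦn.const_mul _)) fun s hs => ?_
          refine (norm_add_le _ _).trans ?_
          rw [norm_mul, norm_mul]
          gcongr
          · exact hwb s hs
          · exact hχX s hs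
      _ = (∫ s in (0 : ℝ)..1, ‖χ' s‖) * b + X * ∫ s in (0 : ℝ)..1, ‖Φ s‖ := by
          rw [intervalIntegral.integral_add (hχ'n.mul_const _) (hΦn.const_mul _),
            intervalIntegral.integral_mul_const, intervalIntegral.integral_const_mul]
      _ ≤ X * b + X * b := by gcongr
      _ = 2 * (X * b) := by ring
  rw [← norm_mul, hid]
  have h1 : ‖χ t * w t‖ ≤ X * b := by
    rw [norm_mul]; exact mul_le_mul (hχX t ht) (hwb t ht) (norm_nonneg _) hX
  have h2 : ‖Complex.exp (Ψ t) * Complex.exp (-Ψ a) * (χ a * w a)‖ ≤ M * (X * b) := by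
    rw [norm_mul, norm_mul (χ a)]
    exact mul_le_mul (hM t ht a left_mem_uIcc)
      (mul_le_mul (hχX a ha) (hwb a ha) (norm_nonneg _) hX) (by positivity) (by linarith)
  refine (norm_sub_le _ _).trans ((add_le_add (norm_sub_le _ _) le_rfl).trans ?_)
  nlinarith [mul_nonneg hX hb]

/-- An integral depending on a complex parameter is holomorphic if the integrand is and is
dominated by a summable function. -/
lemma differentiableOn_intervalIntegral {V : Set ℂ} (hV : IsOpen V) {F : ℂ → ℝ → ℂ}
    {bound : ℝ → ℝ} {a t : ℝ} (ha : a ∈ Icc (0 : ℝ) 1) (ht : t ∈ Icc (0 : ℝ) 1)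
    (hF : ∀ z ∈ V, IntegrableOn (F z) (Icc 0 1))
    (hd : ∀ s ∈ uIoc a t, DifferentiableOn ℂ (fun z => F z s) V)
    (hb : ∀ z ∈ V, ∀ s ∈ uIoc a t, ‖F z s‖ ≤ bound s)
    (hbound : IntegrableOn bound (Icc 0 1)) :
    DifferentiableOn ℂ (fun z => ∫ s in a..t, F z s) V := by
  intro z₀ hz₀
  have hsub : uIoc a t ⊆ Icc 0 1 := uIoc_subset_uIcc.trans (uIcc_subset_Icc ha ht)
  obtain ⟨r, hr, hball⟩ := Metric.isOpen_iff.1 hV z₀ hz₀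
  have hr2 : 0 < r / 2 := half_pos hr
  -- Cauchy's estimate dominates the derivative on the ball of half the radius.
  have hcauchy : ∀ s ∈ uIoc a t, ∀ z ∈ Metric.ball z₀ (r / 2),
      ‖deriv (fun z => F z s) z‖ ≤ bound s / (r / 4) := by
    intro s hs z hz
    have hcb : Metric.closedBall z (r / 4) ⊆ V := by
      refine (Metric.closedBall_subset_ball' ?_).trans hball
      rw [Metric.mem_ball] at hz
      linarith
    refine Complex.norm_deriv_le_of_forall_mem_sphere_norm_le (by linarith)
      (((hd s hs).mono hcb).diffContOnCl_ball le_rfl) fun w hw => ?_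
    exact hb w (hcb (Metric.sphere_subset_closedBall hw)) s hs
  have hmeas : AEStronglyMeasurable (fun s => deriv (fun z => F z s) z₀)
      (volume.restrict (uIoc a t)) := by
    -- The derivative is the limit of difference quotients.
    have hlim : Filter.Tendsto (fun m : ℕ => z₀ + (((r / 2) / (m + 1) : ℝ) : ℂ)) Filter.atTop
        (nhdsWithin z₀ {z₀}ᶜ) := by
      refine tendsto_nhdsWithin_iff.2 ⟨?_, Filter.Eventually.of_forall fun m => ?_⟩
      · have h0 : Filter.Tendsto (fun m : ℕ => (r / 2) / ((m : ℝ) + 1)) Filter.atTop (nhds 0) := by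
          have := (tendsto_one_div_add_atTop_nhds_zero_nat (𝕜 := ℝ)).const_mul (r / 2)
          simpa [div_eq_mul_inv] using this
        have h1 := (Complex.continuous_ofReal.tendsto 0).comp h0
        simpa using h1.const_add z₀
      · have : (0 : ℝ) < (r / 2) / (m + 1) := by positivity
        simpa [Complex.ofReal_eq_zero] using
          (show ((((r / 2) / (m + 1) : ℝ) : ℂ)) ≠ 0 from by exact_mod_cast this.ne')
    refine aestronglyMeasurable_of_tendsto_ae Filter.atTop
      (f := fun (m : ℕ) s => slope (fun z => F z s) z₀ (z₀ + (((r / 2) / (m + 1) : ℝ) : ℂ)))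
      (fun m => ?_) ?_
    · have hmem : z₀ + (((r / 2) / (m + 1) : ℝ) : ℂ) ∈ V := by
        refine hball ?_
        rw [Metric.mem_ball, dist_self_add_left, Complex.norm_real, Real.norm_eq_abs,
          abs_of_pos (by positivity)]
        have : (r / 2) / ((m : ℝ) + 1) ≤ r / 2 := by
          apply div_le_self hr2.le
          have : (0 : ℝ) ≤ m := m.cast_nonneg
          linarith
        linarith
      simp only [slope_def_field]
      simp only [div_eq_mul_inv]
      exact (((hF _ hmem).mono_set hsub).aestronglyMeasurable.sub
        ((hF _ hz₀).mono_set hsub).aestronglyMeasurable).mul_const _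
    · refine (ae_restrict_iff' measurableSet_uIoc).2 (Filter.Eventually.of_forall fun s hs => ?_)
      have := ((hd s hs).differentiableAt (hV.mem_nhds hz₀)).hasDerivAt
      exact (hasDerivAt_iff_tendsto_slope.1 this).comp hlim
  have main := hasDerivAt_integral_of_dominated_loc_of_deriv_le
    (μ := volume.restrict (uIoc a t)) (F := F) (F' := fun z s => deriv (fun z => F z s) z)
    (bound := fun s => bound s / (r / 4))
    (Metric.ball_mem_nhds z₀ hr2)
    (by
      filter_upwards [hV.mem_nhds hz₀] with z hz
      exact ((hF z hz).mono_set hsub).aestronglyMeasurable)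
    ((hF z₀ hz₀).mono_set hsub) hmeas
    ((ae_restrict_iff' measurableSet_uIoc).2 (Filter.Eventually.of_forall fun s hs z hz =>
      hcauchy s hs z hz))
    ((hbound.mono_set hsub).div_const _)
    ((ae_restrict_iff' measurableSet_uIoc).2 (Filter.Eventually.of_forall fun s hs z hz =>
      ((hd s hs).differentiableAt (hV.mem_nhds (hball
        (Metric.ball_subset_ball (by linarith) hz)))).hasDerivAt))
  have h2 := main.2.differentiableAt
  simp only [intervalIntegral.intervalIntegral_eq_integral_uIoc]
  exact (h2.const_smul (if a ≤ t then (1 : ℝ) else -1)).differentiableWithinAt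

/-! ### Fundamental solutions of rapidly oscillating systems -/

open Filter Bornology Topology

/-- The data of a family of systems `v' = ((z + ζ) g(t) diag(ω) + B(t) + R_z(t)) v` on `[0,1]` with
a large parameter `z` in an open set `U`: distinct numbers `ω_j`, a positive weight `g`, a
summable `B` with zero diagonal, a remainder `R_z` that is holomorphic in `z` and at most
`η_z ρ(t)`, where `ρ` is summable and `η_z → 0` as `z → ∞`. The real parts `Re z (ω_j - ω_k)` do not
change sign on `U`. -/
structure OscillatingSystem (n : ℕ) where
  U : Set ℂ
  ω : Fin n → ℂ
  g : ℝ → ℝ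
  ζ : ℂ
  B : Fin n → Fin n → ℝ → ℂ
  R : ℂ → Fin n → Fin n → ℝ → ℂ
  η : ℂ → ℝ
  ρ : ℝ → ℝ
  isOpen_U : IsOpen U
  ω_injective : Function.Injective ω
  g_continuousOn : ContinuousOn g (Icc 0 1)
  g_pos : ∀ t ∈ Icc (0 : ℝ) 1, 0 < g t
  B_integrable : ∀ j l, IntegrableOn (B j l) (Icc 0 1)
  B_diag : ∀ j, B j j = 0
  R_integrable : ∀ z ∈ U, ∀ j l, IntegrableOn (R z j l) (Icc 0 1)
  R_le : ∀ z ∈ U, ∀ j l, ∀ t ∈ Icc (0 : ℝ) 1, ‖R z j l t‖ ≤ η z * ρ t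
  R_differentiableOn : ∀ j l, ∀ t ∈ Icc (0 : ℝ) 1, DifferentiableOn ℂ (fun z => R z j l t) U
  ρ_nonneg : ∀ t, 0 ≤ ρ t
  ρ_integrable : IntegrableOn ρ (Icc 0 1)
  η_tendsto : Tendsto η (cobounded ℂ) (𝓝 0)
  sign : ∀ j k, (∀ z ∈ U, (z * (ω j - ω k)).re ≤ 0) ∨ (∀ z ∈ U, 0 ≤ (z * (ω j - ω k)).re)

namespace OscillatingSystem

variable {n : ℕ} (S : OscillatingSystem n)

/-- The off-diagonal and remainder coefficients together. -/
def N (z : ℂ) (j l : Fin n) (t : ℝ) : ℂ := S.B j l t + S.R z j l t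

/-- The primitive of the weight. -/
def G (t : ℝ) : ℝ := ∫ s in (0 : ℝ)..t, S.g s

/-- The phase of the `j`-th coordinate relative to the `k`-th one. -/
def phase (z : ℂ) (k j : Fin n) (t : ℝ) : ℂ := (z + S.ζ) * (S.ω j - S.ω k) * S.G t

open Classical in
/-- The end of `[0,1]` from which the `j`-th equation is integrated: the one for which the kernel
stays bounded. -/
def base (k j : Fin n) : ℝ := if ∀ z ∈ S.U, (z * (S.ω j - S.ω k)).re ≤ 0 then 0 else 1

/-- The integral operator whose fixed-point equation `u = e_k + K u` is solved by the amplitude of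
the `k`-th fundamental solution. -/
def K (z : ℂ) (k : Fin n) (f : Fin n → ℝ → ℂ) (j : Fin n) : ℝ → ℂ :=
  volterra (S.phase z k j) (S.base k j) (fun s => ∑ l, S.N z j l s * f l s)

/-- The iterates `K^i e_k`. -/
def iter (z : ℂ) (k : Fin n) : ℕ → Fin n → ℝ → ℂ
  | 0 => fun j _ => if j = k then 1 else 0
  | i + 1 => S.K z k (iter z k i)

/-- The amplitude of the `k`-th fundamental solution, as a Neumann series. -/
def amplitude (z : ℂ) (k j : Fin n) (t : ℝ) : ℂ := ∑' i, S.iter z k i j t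

lemma base_mem (k j : Fin n) : S.base k j ∈ Icc (0 : ℝ) 1 := by
  unfold base; split_ifs <;> simp

lemma hasW11Deriv_G : HasW11Deriv S.G S.g :=
  ⟨S.g_continuousOn.integrableOn_Icc, fun t _ => by simp [G]⟩

lemma hasW11Deriv_phase (z : ℂ) (k j : Fin n) :
    HasW11Deriv (S.phase z k j) (fun t => (z + S.ζ) * (S.ω j - S.ω k) * S.g t) :=
  S.hasW11Deriv_G.ofReal.const_mul _

lemma continuousOn_phase (z : ℂ) (k j : Fin n) : ContinuousOn (S.phase z k j) (Icc 0 1) :=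
  (S.hasW11Deriv_phase z k j).continuousOn

lemma monotoneOn_G : MonotoneOn S.G (Icc 0 1) := by
  intro s hs t ht hst
  have hi := S.g_continuousOn.integrableOn_Icc (μ := volume)
  have h : S.G t - S.G s = ∫ x in s..t, S.g x :=
    intervalIntegral.integral_interval_sub_left
      (intervalIntegrable_of_integrableOn_Icc hi (by simp) ht)
      (intervalIntegrable_of_integrableOn_Icc hi (by simp) hs)
  have h2 : 0 ≤ ∫ x in s..t, S.g x :=
    intervalIntegral.integral_nonneg hst fun x hx =>
      (S.g_pos x ⟨hs.1.trans hx.1, hx.2.trans ht.2⟩).le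
  linarith

/-- The kernels of the integral operators are bounded uniformly in the large parameter. -/
lemma exists_kernelBound : ∃ M, 1 ≤ M ∧ ∀ z ∈ S.U, ∀ k j,
    KernelBound (S.phase z k j) (S.base k j) M := by
  obtain ⟨C, hC⟩ := isCompact_Icc.exists_bound_of_continuousOn S.hasW11Deriv_G.continuousOn
  have hC0 : 0 ≤ C := (norm_nonneg _).trans (hC 0 (by simp))
  refine ⟨Real.exp ((∑ j, ∑ k, ‖S.ζ * (S.ω j - S.ω k)‖) * (2 * C)), ?_, ?_⟩
  · refine Real.one_le_exp (mul_nonneg ?_ (by linarith))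
    exact Finset.sum_nonneg fun j _ => Finset.sum_nonneg fun k _ => norm_nonneg _
  intro z hz k j t ht s hs
  have hsI : s ∈ Icc (0 : ℝ) 1 := uIcc_subset_Icc (S.base_mem k j) ht hs
  rw [← Complex.exp_add, Complex.norm_exp]
  refine Real.exp_le_exp.2 ?_
  have hre : (S.phase z k j t + -S.phase z k j s).re =
      (z * (S.ω j - S.ω k)).re * (S.G t - S.G s) +
        (S.ζ * (S.ω j - S.ω k)).re * (S.G t - S.G s) := by
    have : S.phase z k j t + -S.phase z k j s =
        (z * (S.ω j - S.ω k)) * ((S.G t - S.G s : ℝ) : ℂ) +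
          (S.ζ * (S.ω j - S.ω k)) * ((S.G t - S.G s : ℝ) : ℂ) := by
      simp only [phase]; push_cast; ring
    rw [this, Complex.add_re, Complex.re_mul_ofReal, Complex.re_mul_ofReal]
  have h1 : (z * (S.ω j - S.ω k)).re * (S.G t - S.G s) ≤ 0 := by
    unfold base at hs
    split_ifs at hs with hneg
    · rw [uIcc_of_le ht.1] at hs
      exact mul_nonpos_of_nonpos_of_nonneg (hneg z hz)
        (sub_nonneg.2 (S.monotoneOn_G hsI ht hs.2))
    · rw [uIcc_of_ge ht.2] at hs
      exact mul_nonpos_of_nonneg_of_nonpos (((S.sign j k).resolve_left hneg) z hz)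
        (sub_nonpos.2 (S.monotoneOn_G ht hsI hs.1))
  have h2 : (S.ζ * (S.ω j - S.ω k)).re * (S.G t - S.G s) ≤
      (∑ j, ∑ k, ‖S.ζ * (S.ω j - S.ω k)‖) * (2 * C) := by
    refine (le_abs_self _).trans ?_
    rw [abs_mul]
    refine mul_le_mul ?_ ?_ (abs_nonneg _) ?_
    · refine (Complex.abs_re_le_norm _).trans ?_
      refine le_trans ?_ (Finset.single_le_sum (f := fun j => ∑ k, ‖S.ζ * (S.ω j - S.ω k)‖)
        (fun j _ => Finset.sum_nonneg fun k _ => norm_nonneg _) (Finset.mem_univ j))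
      exact Finset.single_le_sum (f := fun k => ‖S.ζ * (S.ω j - S.ω k)‖)
        (fun k _ => norm_nonneg _) (Finset.mem_univ k)
    · have h3 := hC t ht
      have h4 := hC s hsI
      rw [Real.norm_eq_abs] at h3 h4
      calc |S.G t - S.G s| ≤ |S.G t| + |S.G s| := abs_sub _ _
        _ ≤ 2 * C := by linarith
    · exact Finset.sum_nonneg fun j _ => Finset.sum_nonneg fun k _ => norm_nonneg _
  rw [hre]
  linarith

lemma N_integrable {z : ℂ} (hz : z ∈ S.U) (j l : Fin n) : IntegrableOn (S.N z j l) (Icc 0 1) :=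
  (S.B_integrable j l).add (S.R_integrable z hz j l)

lemma integrable_sum_N {z : ℂ} (hz : z ∈ S.U) (j : Fin n) {f : Fin n → ℝ → ℂ}
    (hf : ∀ l, ContinuousOn (f l) (Icc 0 1)) :
    IntegrableOn (fun s => ∑ l, S.N z j l s * f l s) (Icc 0 1) :=
  integrable_finsetSum _ fun l _ => (S.N_integrable hz j l).mul_continuousOn (hf l) isCompact_Icc

lemma hasW11Deriv_K {z : ℂ} (hz : z ∈ S.U) (k j : Fin n) {f : Fin n → ℝ → ℂ}
    (hf : ∀ l, ContinuousOn (f l) (Icc 0 1)) :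
    HasW11Deriv (S.K z k f j) (fun t => (z + S.ζ) * (S.ω j - S.ω k) * S.g t * S.K z k f j t +
      ∑ l, S.N z j l t * f l t) :=
  hasW11Deriv_volterra (S.hasW11Deriv_phase z k j) (S.integrable_sum_N hz j hf) (S.base_mem k j)

lemma continuousOn_iter {z : ℂ} (hz : z ∈ S.U) (k : Fin n) (i : ℕ) (j : Fin n) :
    ContinuousOn (S.iter z k i j) (Icc 0 1) := by
  induction i generalizing j with
  | zero => exact continuousOn_const
  | succ i ih => exact (S.hasW11Deriv_K hz k j ih).continuousOn

/-- A summable function, independent of `z`, that dominates all rows of the coefficients. -/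
def dom (t : ℝ) : ℝ := ∑ j, ∑ l, ‖S.B j l t‖ + n * S.ρ t

lemma dom_integrable : IntegrableOn S.dom (Icc 0 1) :=
  (integrable_finsetSum _ fun j _ => integrable_finsetSum _ fun l _ =>
    (S.B_integrable j l).norm).add (S.ρ_integrable.const_mul _)

lemma norm_sum_N_le {z : ℂ} (hz : z ∈ S.U) (hη : S.η z ≤ 1) (j : Fin n) {f : Fin n → ℂ} {b : ℝ}
    (hf : ∀ l, ‖f l‖ ≤ b) {t : ℝ} (ht : t ∈ Icc (0 : ℝ) 1) :
    ‖∑ l, S.N z j l t * f l‖ ≤ S.dom t * b := by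
  have hb : 0 ≤ b := (norm_nonneg _).trans (hf j)
  have h1 : ∀ l, ‖S.N z j l t * f l‖ ≤ (‖S.B j l t‖ + S.ρ t) * b := by
    intro l
    rw [norm_mul]
    refine mul_le_mul ((norm_add_le _ _).trans (add_le_add le_rfl ?_)) (hf l) (norm_nonneg _)
      (add_nonneg (norm_nonneg _) (S.ρ_nonneg t))
    refine (S.R_le z hz j l t ht).trans ?_
    have := S.ρ_nonneg t
    nlinarith
  refine (norm_sum_le_of_le _ fun l _ => h1 l).trans ?_
  rw [← Finset.sum_mul]
  refine mul_le_mul_of_nonneg_right ?_ hb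
  rw [Finset.sum_add_distrib]
  simp only [Finset.sum_const, Finset.card_univ, Fintype.card_fin, nsmul_eq_mul, dom]
  refine add_le_add ?_ le_rfl
  exact Finset.single_le_sum (f := fun j => ∑ l, ‖S.B j l t‖)
    (fun j _ => Finset.sum_nonneg fun l _ => norm_nonneg _) (Finset.mem_univ j)

lemma integral_norm_sum_N_le {z : ℂ} (hz : z ∈ S.U) (hη : S.η z ≤ 1) (j : Fin n)
    {f : Fin n → ℝ → ℂ} (hf : ∀ l, ContinuousOn (f l) (Icc 0 1)) {b : ℝ}
    (hfb : ∀ l, ∀ t ∈ Icc (0 : ℝ) 1, ‖f l t‖ ≤ b) :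
    ∫ t in (0 : ℝ)..1, ‖∑ l, S.N z j l t * f l t‖ ≤ (∫ t in (0 : ℝ)..1, S.dom t) * b := by
  rw [← intervalIntegral.integral_mul_const]
  refine intervalIntegral.integral_mono_on zero_le_one
    (intervalIntegrable_of_integrableOn_Icc (S.integrable_sum_N hz j hf) (by simp) (by simp)).norm
    ((intervalIntegrable_of_integrableOn_Icc S.dom_integrable (by simp) (by simp)).mul_const _)
    fun t ht => S.norm_sum_N_le hz hη j (fun l => hfb l t ht) ht

/-- Approximation of the off-diagonal coefficients by the weight times a smooth function. -/
lemma exists_smooth_approx {ε : ℝ} (hε : 0 < ε) (j l : Fin n) :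
    ∃ (χ χ' : ℝ → ℂ) (X : ℝ), HasW11Deriv χ χ' ∧ (j = l → χ = 0) ∧
      (∀ t ∈ Icc (0 : ℝ) 1, ‖χ t‖ ≤ X) ∧ ∫ t in (0 : ℝ)..1, ‖χ' t‖ ≤ X ∧
      ∫ t in (0 : ℝ)..1, ‖S.B j l t - S.g t * χ t‖ ≤ ε := by
  by_cases hjl : j = l
  · subst hjl
    refine ⟨0, fun _ => 0, 0, HasW11Deriv.const 0, fun _ => rfl, by simp, by simp, ?_⟩
    simpa [S.B_diag] using hε.le
  obtain ⟨C, hC⟩ := isCompact_Icc.exists_bound_of_continuousOn S.g_continuousOn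
  have hC0 : 0 ≤ C := (norm_nonneg _).trans (hC 0 (by simp))
  have hgc : ContinuousOn (fun t => (S.g t : ℂ)) (Icc 0 1) :=
    Complex.continuous_ofReal.comp_continuousOn S.g_continuousOn
  have hg0 : ∀ t ∈ Icc (0 : ℝ) 1, (S.g t : ℂ) ≠ 0 := fun t ht => by
    exact_mod_cast (S.g_pos t ht).ne'
  have hBg : IntegrableOn (fun t => S.B j l t * (S.g t : ℂ)⁻¹) (Icc 0 1) :=
    (S.B_integrable j l).mul_continuousOn (hgc.inv₀ hg0) isCompact_Icc
  obtain ⟨χ, hχ, -, -, happ⟩ := exists_contDiff_integral_sub_le hBg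
    (show 0 < ε / (C + 1) by positivity)
  obtain ⟨X, hX⟩ := isCompact_Icc.exists_bound_of_continuousOn
    (hχ.continuous.continuousOn (s := Icc (0 : ℝ) 1))
  have hχi : IntegrableOn χ (Icc 0 1) := hχ.continuous.continuousOn.integrableOn_Icc
  refine ⟨χ, deriv χ, max X (∫ t in (0 : ℝ)..1, ‖deriv χ t‖), HasW11Deriv.of_contDiff hχ,
    fun h => absurd h hjl, fun t ht => (hX t ht).trans (le_max_left _ _), le_max_right _ _, ?_⟩
  have hdiff : IntegrableOn (fun t => S.B j l t * (S.g t : ℂ)⁻¹ - χ t) (Icc 0 1) := hBg.sub hχi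
  have hdiff2 : IntegrableOn (fun t => S.B j l t - S.g t * χ t) (Icc 0 1) :=
    (S.B_integrable j l).sub (hχi.continuousOn_mul hgc isCompact_Icc)
  calc ∫ t in (0 : ℝ)..1, ‖S.B j l t - S.g t * χ t‖
      ≤ ∫ t in (0 : ℝ)..1, C * ‖S.B j l t * (S.g t : ℂ)⁻¹ - χ t‖ := by
        refine intervalIntegral.integral_mono_on zero_le_one
          (intervalIntegrable_of_integrableOn_Icc hdiff2 (by simp) (by simp)).norm
          ((intervalIntegrable_of_integrableOn_Icc hdiff (by simp) (by simp)).norm.const_mul _)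
          fun t ht => ?_
        have h1 : S.B j l t - S.g t * χ t = S.g t * (S.B j l t * (S.g t : ℂ)⁻¹ - χ t) := by
          have := hg0 t ht
          field_simp
        rw [h1, norm_mul, Complex.norm_real]
        gcongr
        exact hC t ht
    _ ≤ C * (ε / (C + 1)) := by
        rw [intervalIntegral.integral_const_mul]
        gcongr
    _ ≤ ε := by
        rw [mul_div_assoc', div_le_iff₀ (by positivity)]
        nlinarith

lemma eventually_large (c : ℂ) (hc : c ≠ 0) (A : ℝ) :
    ∀ᶠ z in cobounded ℂ, A ≤ ‖(z + S.ζ) * c‖ := by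
  have h : Tendsto (fun z : ℂ => ‖(z + S.ζ) * c‖) (cobounded ℂ) atTop := by
    simp only [norm_mul]
    refine Tendsto.atTop_mul_const (norm_pos_iff.2 hc) ?_
    refine tendsto_atTop_mono (fun z => norm_sub_le_norm_add z S.ζ) ?_
    simpa [sub_eq_add_neg] using
      tendsto_atTop_add_const_right (cobounded ℂ) (-‖S.ζ‖) tendsto_norm_cobounded_atTop
  exact h.eventually_ge_atTop A

/-- The smoothing estimate: on functions that oscillate like solutions of the system, the integral
operator is small for large `z`, because no coordinate oscillates at the rate of another one. -/
lemma eventually_norm_K_le {ε : ℝ} (hε : 0 < ε) : ∀ᶠ z in cobounded ℂ, z ∈ S.U →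
    ∀ (k : Fin n) (w Φ : Fin n → ℝ → ℂ) (b : ℝ), (∀ l, IntegrableOn (Φ l) (Icc 0 1)) →
    (∀ l, HasW11Deriv (w l)
      (fun t => (z + S.ζ) * (S.ω l - S.ω k) * S.g t * w l t + Φ l t)) →
    (∀ l, ∀ t ∈ Icc (0 : ℝ) 1, ‖w l t‖ ≤ b) → (∀ l, ∫ t in (0 : ℝ)..1, ‖Φ l t‖ ≤ b) →
    ∀ j, ∀ t ∈ Icc (0 : ℝ) 1, ‖S.K z k w j t‖ ≤ ε * b := by
  obtain ⟨M, hM1, hM⟩ := S.exists_kernelBound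
  have hM0 : 0 < M := by linarith
  set δ : ℝ := ε / ((n + 1) * (2 * M + 1)) with hδ
  have hδ0 : 0 < δ := by positivity
  choose χ χ' X hχ hχ0 hχX hχ'X happ using fun j l => S.exists_smooth_approx hδ0 j l
  set P : ℝ := ∫ t in (0 : ℝ)..1, S.ρ t with hP
  have hP0 : 0 ≤ P := intervalIntegral.integral_nonneg zero_le_one fun t _ => S.ρ_nonneg t
  have hη : ∀ᶠ z in cobounded ℂ, S.η z < δ / (P + 1) :=
    S.η_tendsto.eventually_lt_const (by positivity)
  have hlarge : ∀ᶠ z in cobounded ℂ, ∀ j l, j ≠ l →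
      4 * M * X j l / δ + 1 ≤ ‖(z + S.ζ) * (S.ω l - S.ω j)‖ := by
    refine eventually_all.2 fun j => eventually_all.2 fun l => ?_
    by_cases hjl : j = l
    · exact Eventually.of_forall fun z h => absurd hjl h
    · filter_upwards [S.eventually_large (S.ω l - S.ω j)
        (sub_ne_zero.2 fun h => hjl (S.ω_injective h).symm) (4 * M * X j l / δ + 1)] with z hz _
      exact hz
  filter_upwards [hη, hlarge] with z hηz hz hzU k w Φ b hΦ hw hwb hΦb j t ht
  have hb : 0 ≤ b := (norm_nonneg _).trans (hwb j 0 (by simp))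
  have hgc : ContinuousOn (fun t => (S.g t : ℂ)) (Icc 0 1) :=
    Complex.continuous_ofReal.comp_continuousOn S.g_continuousOn
  have hψ := S.continuousOn_phase z k j
  have hwc := fun l => (hw l).continuousOn
  have hBχ : ∀ l, IntegrableOn (fun s => S.B j l s - S.g s * χ j l s) (Icc 0 1) := fun l =>
    (S.B_integrable j l).sub ((hgc.mul (hχ j l).continuousOn).integrableOn_Icc)
  -- `N w = ((B - g χ) w + R w) + g χ w`; the first two terms are small in `L_1`.
  have hi1 : ∀ l, IntegrableOn (fun s => (S.B j l s - S.g s * χ j l s) * w l s +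
      S.R z j l s * w l s) (Icc 0 1) := fun l =>
    ((hBχ l).mul_continuousOn (hwc l) isCompact_Icc).add
      ((S.R_integrable z hzU j l).mul_continuousOn (hwc l) isCompact_Icc)
  have hi2 : ∀ l, IntegrableOn (fun s => S.g s * χ j l s * w l s) (Icc 0 1) := fun l =>
    ((hgc.mul (hχ j l).continuousOn).mul (hwc l)).integrableOn_Icc
  have hi12 : ∀ l, IntegrableOn (fun s => (S.B j l s - S.g s * χ j l s) * w l s +
      S.R z j l s * w l s + S.g s * χ j l s * w l s) (Icc 0 1) := fun l => (hi1 l).add (hi2 l)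
  have hKeq : S.K z k w j t = ∑ l, (volterra (S.phase z k j) (S.base k j)
      (fun s => (S.B j l s - S.g s * χ j l s) * w l s + S.R z j l s * w l s) t +
      volterra (S.phase z k j) (S.base k j) (fun s => S.g s * χ j l s * w l s) t) := by
    have h1 : (fun s => ∑ l, S.N z j l s * w l s) = fun s => ∑ l,
        (((S.B j l s - S.g s * χ j l s) * w l s + S.R z j l s * w l s) +
          S.g s * χ j l s * w l s) := by
      funext s
      refine Finset.sum_congr rfl fun l _ => ?_
      simp only [N]; ring
    rw [K, h1, volterra_sum _ hψ (fun l _ => hi12 l) (S.base_mem k j) ht]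
    exact Finset.sum_congr rfl fun l _ =>
      volterra_add hψ (hi1 l) (hi2 l) (S.base_mem k j) ht
  have hsmall : ∀ l, ‖volterra (S.phase z k j) (S.base k j)
      (fun s => (S.B j l s - S.g s * χ j l s) * w l s + S.R z j l s * w l s) t‖ ≤
        M * (2 * δ * b) := by
    intro l
    refine (norm_volterra_le hψ (hi1 l) (S.base_mem k j) (hM z hzU k j) ht).trans ?_
    refine mul_le_mul_of_nonneg_left ?_ hM0.le
    have hn1 := (intervalIntegrable_of_integrableOn_Icc (hBχ l)
      (left_mem_Icc.2 zero_le_one) (right_mem_Icc.2 zero_le_one)).norm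
    have hn2 := intervalIntegrable_of_integrableOn_Icc S.ρ_integrable
      (left_mem_Icc.2 zero_le_one) (right_mem_Icc.2 zero_le_one)
    calc ∫ s in (0 : ℝ)..1, ‖(S.B j l s - S.g s * χ j l s) * w l s + S.R z j l s * w l s‖
        ≤ ∫ s in (0 : ℝ)..1, (‖S.B j l s - S.g s * χ j l s‖ * b +
            δ / (P + 1) * b * S.ρ s) := by
          refine intervalIntegral.integral_mono_on zero_le_one
            (intervalIntegrable_of_integrableOn_Icc (hi1 l) (by simp) (by simp)).norm
            ((hn1.mul_const _).add (hn2.const_mul _)) fun s hs => ?_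
          refine (norm_add_le _ _).trans ?_
          rw [norm_mul, norm_mul]
          refine add_le_add ?_ ?_
          · gcongr
            exact hwb l s hs
          · have h1 : ‖S.R z j l s‖ ≤ δ / (P + 1) * S.ρ s :=
              (S.R_le z hzU j l s hs).trans
                (mul_le_mul_of_nonneg_right hηz.le (S.ρ_nonneg s))
            calc ‖S.R z j l s‖ * ‖w l s‖ ≤ (δ / (P + 1) * S.ρ s) * b :=
                  mul_le_mul h1 (hwb l s hs) (norm_nonneg _)
                    (mul_nonneg (by positivity) (S.ρ_nonneg s))
              _ = δ / (P + 1) * b * S.ρ s := by ring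
      _ = (∫ s in (0 : ℝ)..1, ‖S.B j l s - S.g s * χ j l s‖) * b + δ / (P + 1) * b * P := by
          rw [intervalIntegral.integral_add (hn1.mul_const _) (hn2.const_mul _),
            intervalIntegral.integral_mul_const, intervalIntegral.integral_const_mul]
      _ ≤ δ * b + δ * b := by
          refine add_le_add (mul_le_mul_of_nonneg_right (happ j l) hb) ?_
          rw [mul_right_comm]
          refine mul_le_mul_of_nonneg_right ?_ hb
          rw [div_mul_eq_mul_div, div_le_iff₀ (by positivity)]
          nlinarith
      _ = 2 * δ * b := by ring
  have hosc : ∀ l, ‖volterra (S.phase z k j) (S.base k j)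
      (fun s => S.g s * χ j l s * w l s) t‖ ≤ δ * b := by
    intro l
    by_cases hjl : j = l
    · have h0 : χ j l = 0 := hχ0 j l hjl
      simp only [h0, volterra, Pi.zero_apply, mul_zero, zero_mul, intervalIntegral.integral_zero,
        norm_zero]
      positivity
    have h1 := norm_mul_norm_volterra_le (ν := fun t => (z + S.ζ) * (S.ω l - S.ω k) * S.g t)
      (c := (z + S.ζ) * (S.ω l - S.ω j)) (S.hasW11Deriv_phase z k j)
      (S.base_mem k j) (hM z hzU k j) hM1 (hχ j l) (hχX j l) (hχ'X j l) (hΦ l) (hw l) (hwb l)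
      (hΦb l) hgc (fun s _ => by ring) ht
    have h2 := hz j l hjl
    have hX0 : 0 ≤ X j l := (norm_nonneg _).trans (hχX j l 0 (by simp))
    have hc0 : 0 < ‖(z + S.ζ) * (S.ω l - S.ω j)‖ := by
      have : 0 ≤ 4 * M * X j l / δ := by positivity
      linarith
    refine le_of_mul_le_mul_left (h1.trans ?_) hc0
    have h3 : 4 * M * X j l ≤ ‖(z + S.ζ) * (S.ω l - S.ω j)‖ * δ :=
      (div_le_iff₀ hδ0).1 (by linarith)
    nlinarith
  rw [hKeq]
  refine (norm_sum_le_of_le _ fun l _ => (norm_add_le _ _).trans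
    (add_le_add (hsmall l) (hosc l))).trans ?_
  simp only [Finset.sum_const, Finset.card_univ, Fintype.card_fin, nsmul_eq_mul]
  have h3 : ε = (n + 1) * (2 * M + 1) * δ := by rw [hδ]; field_simp
  rw [h3]
  have h4 : 0 ≤ (2 * M + 1) * δ * b := by positivity
  nlinarith

end OscillatingSystem

/-! ### Neumann series for the amplitudes -/

namespace OscillatingSystem

variable {n : ℕ} (S : OscillatingSystem n)

/-- The terms of the Neumann series decay geometrically with an arbitrarily small ratio. The
operator `K` itself need not be small; it is `K²` that is, and this suffices. -/
lemma eventually_norm_iter_le {θ : ℝ} (hθ : 0 < θ) (hθ1 : θ ≤ 1) : ∀ᶠ z in cobounded ℂ, z ∈ S.U →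
    S.η z ≤ 1 ∧ ∀ k i j, ∀ t ∈ Icc (0 : ℝ) 1, ‖S.iter z k i j t‖ ≤ θ ^ i := by
  set D : ℝ := ∫ t in (0 : ℝ)..1, S.dom t with hD
  have hD0 : 0 ≤ D := intervalIntegral.integral_nonneg zero_le_one fun t _ =>
    add_nonneg (Finset.sum_nonneg fun j _ => Finset.sum_nonneg fun l _ => norm_nonneg _)
      (mul_nonneg n.cast_nonneg (S.ρ_nonneg t))
  filter_upwards [S.eventually_norm_K_le (show 0 < θ ^ 2 / (D + 1) by positivity),
    S.η_tendsto.eventually_le_const (zero_lt_one)] with z hK hη hz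
  refine ⟨hη, fun k => ?_⟩
  have hcst : ∀ j, ∀ t ∈ Icc (0 : ℝ) 1, ‖S.iter z k 0 j t‖ ≤ 1 := by
    intro j t _
    simp only [iter]
    split_ifs <;> simp
  have h1 : ∀ j, ∀ t ∈ Icc (0 : ℝ) 1, ‖S.iter z k 1 j t‖ ≤ θ := by
    intro j t ht
    refine (hK hz k (S.iter z k 0) (fun _ _ => 0) 1 (fun l => by simp) (fun l => ?_) hcst
      (fun l => by simp) j t ht).trans ?_
    · refine (HasW11Deriv.const (if l = k then (1 : ℂ) else 0)).congr (fun _ _ => rfl)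
        (Eventually.of_forall fun t _ => ?_)
      simp only [iter]
      split_ifs with h
      · simp [h]
      · simp
    · rw [mul_one, div_le_iff₀ (by positivity)]
      nlinarith [mul_nonneg hθ.le hD0]
  intro i
  induction i using Nat.twoStepInduction with
  | zero => simpa using hcst
  | one => simpa using h1
  | more i ih1 ih2 =>
    intro j t ht
    -- `K^{i+1} e_k` solves a system of the same shape with the right-hand side `N K^i e_k`.
    have hc := fun l => S.continuousOn_iter hz k i l
    refine (hK hz k (S.iter z k (i + 1)) (fun l s => ∑ m, S.N z l m s * S.iter z k i m s)
      ((D + 1) * θ ^ i) (fun l => S.integrable_sum_N hz l hc)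
      (fun l => S.hasW11Deriv_K hz k l hc) (fun l s hs => (ih2 l s hs).trans ?_)
      (fun l => (S.integral_norm_sum_N_le hz hη l hc ih1).trans ?_) j t ht).trans ?_
    · have h2 : 0 ≤ θ ^ i := by positivity
      have h3 : θ ^ (i + 1) ≤ θ ^ i := pow_le_pow_of_le_one hθ.le hθ1 (Nat.le_succ i)
      nlinarith
    · have h2 : 0 ≤ θ ^ i := by positivity
      nlinarith
    · rw [← mul_assoc, div_mul_cancel₀ _ (by positivity), ← pow_add, add_comm]

lemma differentiable_phase (k j : Fin n) (t : ℝ) :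
    Differentiable ℂ (fun z => S.phase z k j t) := by
  unfold phase; fun_prop

lemma differentiableOn_iter {V : Set ℂ} (hV : IsOpen V) (hVU : V ⊆ S.U)
    (hb : ∀ z ∈ V, S.η z ≤ 1 ∧ ∀ k i j, ∀ t ∈ Icc (0 : ℝ) 1, ‖S.iter z k i j t‖ ≤ 1)
    (k : Fin n) (i : ℕ) (j : Fin n) {t : ℝ} (ht : t ∈ Icc (0 : ℝ) 1) :
    DifferentiableOn ℂ (fun z => S.iter z k i j t) V := by
  obtain ⟨M, hM1, hM⟩ := S.exists_kernelBound
  induction i generalizing j t with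
  | zero => exact differentiableOn_const _
  | succ i ih =>
    have hsub : uIoc (S.base k j) t ⊆ Icc 0 1 :=
      uIoc_subset_uIcc.trans (uIcc_subset_Icc (S.base_mem k j) ht)
    have heq : (fun z => S.iter z k (i + 1) j t) = fun z => ∫ s in (S.base k j)..t,
        Complex.exp (S.phase z k j t) * (Complex.exp (-S.phase z k j s) *
          ∑ l, S.N z j l s * S.iter z k i l s) := by
      funext z
      rw [intervalIntegral.integral_const_mul]
      rfl
    rw [heq]
    refine differentiableOn_intervalIntegral hV (bound := fun s => M * (S.dom s * 1))
      (S.base_mem k j) ht (fun z hz => ?_) (fun s hs => ?_) (fun z hz s hs => ?_)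
      ((S.dom_integrable.mul_const _).const_mul _)
    · exact (integrableOn_exp_neg_mul (S.continuousOn_phase z k j)
        (S.integrable_sum_N (hVU hz) j fun l => S.continuousOn_iter (hVU hz) k i l)).const_mul _
    · refine ((S.differentiable_phase k j t).cexp.differentiableOn).mul
        (((S.differentiable_phase k j s).neg.cexp.differentiableOn).mul ?_)
      refine DifferentiableOn.fun_sum fun l _ => DifferentiableOn.mul ?_ (ih l (hsub hs))
      exact (differentiableOn_const _).add ((S.R_differentiableOn j l s (hsub hs)).mono hVU)
    · rw [← mul_assoc, norm_mul]
      refine mul_le_mul (hM z (hVU hz) k j t ht s (uIoc_subset_uIcc hs))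
        (S.norm_sum_N_le (hVU hz) (hb z hz).1 j (fun l => (hb z hz).2 k i l s (hsub hs)) (hsub hs))
        (norm_nonneg _) (by linarith)

/-- The Neumann series solves `u = e_k + K u`. -/
lemma amplitude_eq {z : ℂ} (hz : z ∈ S.U) (hη : S.η z ≤ 1) {k : Fin n}
    (hb : ∀ i j, ∀ t ∈ Icc (0 : ℝ) 1, ‖S.iter z k i j t‖ ≤ (1 / 2) ^ i)
    (j : Fin n) {t : ℝ} (ht : t ∈ Icc (0 : ℝ) 1) :
    S.amplitude z k j t = (if j = k then 1 else 0) + S.K z k (S.amplitude z k) j t := by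
  have hgeo : Summable fun i : ℕ => ((1 : ℝ) / 2) ^ i := summable_geometric_two
  have hsum : ∀ l, ∀ s ∈ Icc (0 : ℝ) 1,
      HasSum (fun i => S.iter z k i l s) (S.amplitude z k l s) := fun l s hs =>
    (Summable.of_norm_bounded hgeo fun i => hb i l s hs).hasSum
  have hsub : uIoc (S.base k j) t ⊆ Icc 0 1 :=
    uIoc_subset_uIcc.trans (uIcc_subset_Icc (S.base_mem k j) ht)
  have hexp := continuousOn_exp_neg (S.continuousOn_phase z k j)
  have hint := intervalIntegral.hasSum_integral_of_dominated_convergence (μ := volume)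
    (a := S.base k j) (b := t)
    (F := fun i s => Complex.exp (-S.phase z k j s) * ∑ l, S.N z j l s * S.iter z k i l s)
    (f := fun s => Complex.exp (-S.phase z k j s) * ∑ l, S.N z j l s * S.amplitude z k l s)
    (fun i s => ‖Complex.exp (-S.phase z k j s)‖ * S.dom s * (1 / 2) ^ i)
    (fun i => ((integrableOn_exp_neg_mul (S.continuousOn_phase z k j)
      (S.integrable_sum_N hz j fun l => S.continuousOn_iter hz k i l)).mono_set
        hsub).aestronglyMeasurable)
    (fun i => Eventually.of_forall fun s hs => by
      rw [norm_mul, mul_assoc]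
      exact mul_le_mul_of_nonneg_left (S.norm_sum_N_le hz hη j (fun l => hb i l s (hsub hs))
        (hsub hs)) (norm_nonneg _))
    (Eventually.of_forall fun s _ => hgeo.mul_left _)
    (by
      simp only [tsum_mul_left]
      exact intervalIntegrable_of_integrableOn_Icc
        ((S.dom_integrable.continuousOn_mul hexp.norm isCompact_Icc).mul_const _)
        (S.base_mem k j) ht)
    (Eventually.of_forall fun s hs =>
      (hasSum_sum fun l _ => (hsum l s (hsub hs)).mul_left _).mul_left _)
  have hK : HasSum (fun i => S.iter z k (i + 1) j t) (S.K z k (S.amplitude z k) j t) :=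
    hint.mul_left (Complex.exp (S.phase z k j t))
  have h0 := (hsum j t ht).summable.tsum_eq_zero_add
  rw [hK.tsum_eq] at h0
  exact h0

/-- For large `z` the amplitudes satisfy the system, are holomorphic in `z`, and tend to the
standard basis vectors uniformly in `t`. -/
theorem exists_amplitude : ∃ R₀ : ℝ, 0 < R₀ ∧
    (∀ z ∈ S.U, R₀ < ‖z‖ → ∀ k j, HasW11Deriv (S.amplitude z k j)
      (fun t => (z + S.ζ) * (S.ω j - S.ω k) * S.g t * S.amplitude z k j t +
        ∑ l, S.N z j l t * S.amplitude z k l t)) ∧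
    (∀ k j, ∀ t ∈ Icc (0 : ℝ) 1,
      DifferentiableOn ℂ (fun z => S.amplitude z k j t) {z | z ∈ S.U ∧ R₀ < ‖z‖}) ∧
    ∀ ε : ℝ, 0 < ε → ∃ R' : ℝ, R₀ ≤ R' ∧ ∀ z ∈ S.U, R' < ‖z‖ → ∀ k j, ∀ t ∈ Icc (0 : ℝ) 1,
      ‖S.amplitude z k j t - if j = k then 1 else 0‖ < ε := by
  have hlarge : ∀ θ : ℝ, 0 < θ → θ ≤ 1 → ∃ r : ℝ, ∀ z ∈ S.U, r < ‖z‖ →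
      S.η z ≤ 1 ∧ ∀ k i j, ∀ t ∈ Icc (0 : ℝ) 1, ‖S.iter z k i j t‖ ≤ θ ^ i := by
    intro θ hθ hθ1
    obtain ⟨r, -, hr⟩ := (Filter.hasBasis_cobounded_norm (E := ℂ)).eventually_iff.1
      (S.eventually_norm_iter_le hθ hθ1)
    exact ⟨r, fun z hz hrz => hr hrz.le hz⟩
  have hgeo : Summable fun i : ℕ => ((1 : ℝ) / 2) ^ i := summable_geometric_two
  obtain ⟨r, hr⟩ := hlarge (1 / 2) (by norm_num) (by norm_num)
  refine ⟨max r 1, by positivity, fun z hz hzr k j => ?_, fun k j t ht => ?_, fun ε hε => ?_⟩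
  · obtain ⟨hη, hb⟩ := hr z hz ((le_max_left _ _).trans_lt hzr)
    have hc : ∀ j, ContinuousOn (S.amplitude z k j) (Icc 0 1) := fun j =>
      continuousOn_tsum (fun i => S.continuousOn_iter hz k i j) hgeo fun i t ht => hb k i j t ht
    have heq := fun (t : ℝ) (ht : t ∈ Icc (0 : ℝ) 1) => S.amplitude_eq hz hη (hb k) j ht
    refine ((HasW11Deriv.const (if j = k then (1 : ℂ) else 0)).add
      (S.hasW11Deriv_K hz k j hc)).congr (fun t ht => (heq t ht).symm)
      (Eventually.of_forall fun t ht => ?_)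
    rw [heq t ht]
    split_ifs with h
    · simp [h]
    · simp
  · have hV : IsOpen {z | z ∈ S.U ∧ max r 1 < ‖z‖} :=
      S.isOpen_U.inter (isOpen_lt continuous_const continuous_norm)
    have hrV : ∀ z ∈ {z | z ∈ S.U ∧ max r 1 < ‖z‖}, r < ‖z‖ := fun z hz =>
      (le_max_left _ _).trans_lt hz.2
    refine Complex.differentiableOn_tsum_of_summable_norm hgeo (fun i => ?_) hV
      fun i z hz => (hr z hz.1 (hrV z hz)).2 k i j t ht
    refine S.differentiableOn_iter hV (fun z hz => hz.1) (fun z hz => ?_) k i j ht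
    obtain ⟨hη, hb⟩ := hr z hz.1 (hrV z hz)
    exact ⟨hη, fun k i j t ht => (hb k i j t ht).trans (pow_le_one₀ (by norm_num) (by norm_num))⟩
  · set θ : ℝ := min (1 / 2) (ε / 4) with hθ
    have hθ0 : 0 < θ := by positivity
    have hθ2 : θ ≤ 1 / 2 := min_le_left _ _
    have hθε : θ ≤ ε / 4 := min_le_right _ _
    obtain ⟨r', hr'⟩ := hlarge θ hθ0 (hθ2.trans (by norm_num))
    refine ⟨max r' (max r 1), le_max_right _ _, fun z hz hzr k j t ht => ?_⟩
    obtain ⟨-, hb⟩ := hr' z hz ((le_max_left _ _).trans_lt hzr)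
    have hgeoθ := (hasSum_geometric_of_lt_one hθ0.le (by linarith : θ < 1)).mul_left θ
    have hs : Summable fun i => S.iter z k i j t :=
      Summable.of_norm_bounded (summable_geometric_of_lt_one hθ0.le (by linarith))
        fun i => hb k i j t ht
    have h1 : S.amplitude z k j t - (if j = k then 1 else 0) = ∑' i, S.iter z k (i + 1) j t := by
      rw [amplitude, hs.tsum_eq_zero_add]
      simp only [iter, add_sub_cancel_left]
    rw [h1]
    refine (tsum_of_norm_bounded hgeoθ fun i => ?_).trans_lt ?_
    · rw [← pow_succ']; exact hb k (i + 1) j t ht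
    · rw [← div_eq_mul_inv, div_lt_iff₀ (by linarith)]
      nlinarith

end OscillatingSystem

/-! ### The transforming matrix -/

section Roots

variable {n : ℕ}

lemma rootU_eq_pow (k : Fin n) : rootU k = Complex.exp (2 * Real.pi * Complex.I / n) ^ (k.val + 1) := by
  rw [rootU, ← Complex.exp_nat_mul]
  push_cast
  ring_nf

lemma rootU_ne_zero (k : Fin n) : rootU k ≠ 0 := Complex.exp_ne_zero _

lemma rootU_pow_card (k : Fin n) : rootU k ^ n = 1 := by
  have hn : n ≠ 0 := fun h => by subst h; exact k.elim0
  rw [rootU_eq_pow, pow_right_comm,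
    (Complex.isPrimitiveRoot_exp n hn).pow_eq_one, one_pow]

lemma norm_rootU (k : Fin n) : ‖rootU k‖ = 1 :=
  Complex.norm_eq_one_of_pow_eq_one (rootU_pow_card k) fun h => by subst h; exact k.elim0

lemma rootU_injective : Function.Injective (rootU (n := n)) := by
  intro j k hjk
  have hn : n ≠ 0 := fun h => by subst h; exact k.elim0
  rw [rootU_eq_pow, rootU_eq_pow, pow_succ, pow_succ] at hjk
  exact Fin.ext ((Complex.isPrimitiveRoot_exp n hn).pow_inj j.2 k.2
    (mul_right_cancel₀ (Complex.exp_ne_zero _) hjk))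

/-- The matrix `(ω_k^l)_{l,k}` of the discrete Fourier transform. -/
def dft (n : ℕ) : Matrix (Fin n) (Fin n) ℂ := fun l k => rootU k ^ l.val

/-- The inverse of `dft`. -/
def dftInv (n : ℕ) : Matrix (Fin n) (Fin n) ℂ := fun k l => (n : ℂ)⁻¹ * (rootU k ^ l.val)⁻¹

lemma dftInv_mul_dft (n : ℕ) : dftInv n * dft n = 1 := by
  ext j k
  have hn : (n : ℂ) ≠ 0 := Nat.cast_ne_zero.2 fun h => by subst h; exact k.elim0
  have h1 : (dftInv n * dft n) j k = (n : ℂ)⁻¹ * ∑ l ∈ Finset.range n, (rootU k / rootU j) ^ l := by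
    rw [Matrix.mul_apply, Finset.mul_sum, ← Fin.sum_univ_eq_sum_range
      (fun l => (n : ℂ)⁻¹ * (rootU k / rootU j) ^ l)]
    refine Finset.sum_congr rfl fun l _ => ?_
    rw [dft, dftInv, div_pow, div_eq_mul_inv]
    ring
  rw [h1]
  by_cases hjk : j = k
  · subst hjk
    rw [div_self (rootU_ne_zero j)]
    simp [hn]
  · rw [Matrix.one_apply_ne hjk]
    have hne : rootU k / rootU j - 1 ≠ 0 := by
      rw [sub_ne_zero, Ne, div_eq_one_iff_eq (rootU_ne_zero j)]
      exact fun h => hjk (rootU_injective h).symm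
    have h2 := geom_sum_mul (rootU k / rootU j) n
    rw [div_pow, rootU_pow_card, rootU_pow_card, div_one, sub_self] at h2
    rw [(mul_eq_zero.1 h2).resolve_right hne, mul_zero]

end Roots

section Weights

variable {n : ℕ} (p p' : Fin n → ℝ → ℝ)

/-- The logarithm of `g^a / ∏_{m<a} p_m`, where `g` is the geometric mean. -/
def logWeight (a : Fin n) (t : ℝ) : ℝ :=
  a.val * ((∑ m, Real.log (p m t)) / n) - ∑ m with m < a, Real.log (p m t)

/-- The derivative of `logWeight`. -/
def logWeightDeriv (a : Fin n) (t : ℝ) : ℝ :=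
  a.val * ((∑ m, p' m t / p m t) / n) - ∑ m with m < a, p' m t / p m t

/-- The positive weights `g^a / ∏_{m<a} p_m`: the `t`-dependence of the rows of `Smat`. -/
def weight (a : Fin n) (t : ℝ) : ℝ := Real.exp (logWeight p a t)

variable {p p'}

lemma weight_ne_zero (a : Fin n) (t : ℝ) : (weight p a t : ℂ) ≠ 0 :=
  Complex.ofReal_ne_zero.2 (Real.exp_pos _).ne'

lemma hasW11Deriv_logWeight (hp : ∀ k, HasW11Deriv (p k) (p' k))
    (hpos : ∀ k, ∀ t ∈ Icc (0 : ℝ) 1, 0 < p k t) (a : Fin n) :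
    HasW11Deriv (logWeight p a) (logWeightDeriv p p' a) := by
  have hlog := fun m => (hp m).log (hpos m)
  have h1 := (HasW11Deriv.sum Finset.univ fun m _ => hlog m).clm_comp
    (ContinuousLinearMap.mul ℝ ℝ ((a.val : ℝ) / n))
  have h2 := (HasW11Deriv.sum (Finset.univ.filter (· < a)) fun m _ => hlog m).clm_comp
    (-ContinuousLinearMap.id ℝ ℝ)
  refine (h1.add h2).congr (fun t _ => ?_) (Eventually.of_forall fun t _ => ?_)
  · simp only [ContinuousLinearMap.mul_apply', neg_apply,
      ContinuousLinearMap.id_apply, logWeight]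
    ring
  · simp only [ContinuousLinearMap.mul_apply', neg_apply,
      ContinuousLinearMap.id_apply, logWeightDeriv]
    ring

lemma geomMean_eq_exp {t : ℝ} (hpos : ∀ k, 0 < p k t) :
    geomMean p t = Real.exp ((∑ m, Real.log (p m t)) / n) := by
  rw [geomMean, Real.rpow_def_of_pos (Finset.prod_pos fun m _ => hpos m),
    Real.log_prod fun m _ => (hpos m).ne', mul_one_div]

lemma geomMean_pos {t : ℝ} (hpos : ∀ k, 0 < p k t) : 0 < geomMean p t := by
  rw [geomMean_eq_exp hpos]; exact Real.exp_pos _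

lemma geomMean_pow (hn : n ≠ 0) {t : ℝ} (hpos : ∀ k, 0 < p k t) :
    geomMean p t ^ n = ∏ m, p m t := by
  have h := (Finset.prod_pos fun m (_ : m ∈ Finset.univ) => hpos m).le
  rw [geomMean, one_div, Real.rpow_inv_natCast_pow h hn]

lemma memW11_geomMean (hp : ∀ k, HasW11Deriv (p k) (p' k))
    (hpos : ∀ k, ∀ t ∈ Icc (0 : ℝ) 1, 0 < p k t) : MemW11 (fun t => (geomMean p t : ℂ)) := by
  have h1 := (HasW11Deriv.sum Finset.univ fun m _ => (hp m).log (hpos m)).clm_comp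
    (ContinuousLinearMap.mul ℝ ℝ (n : ℝ)⁻¹)
  refine ⟨_, h1.ofReal.cexp.congr (fun t ht => ?_) (Eventually.of_forall fun _ _ => rfl)⟩
  rw [geomMean_eq_exp fun k => hpos k t ht, Complex.ofReal_exp]
  simp only [ContinuousLinearMap.mul_apply']
  rw [div_eq_inv_mul]

lemma continuousOn_geomMean (hp : ∀ k, HasW11Deriv (p k) (p' k))
    (hpos : ∀ k, ∀ t ∈ Icc (0 : ℝ) 1, 0 < p k t) : ContinuousOn (geomMean p) (Icc 0 1) := by
  obtain ⟨g', hg'⟩ := memW11_geomMean hp hpos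
  have h := Complex.continuous_re.comp_continuousOn hg'.continuousOn
  exact h.congr fun t _ => (Complex.ofReal_re _).symm

lemma weight_eq {t : ℝ} (hpos : ∀ k, 0 < p k t) (a : Fin n) :
    weight p a t = geomMean p t ^ a.val * ∏ m with m < a, (p m t)⁻¹ := by
  rw [weight, logWeight, Real.exp_sub, Real.exp_nat_mul, ← geomMean_eq_exp hpos, Real.exp_sum,
    Finset.prod_inv_distrib, div_eq_mul_inv]
  congr 2
  exact Finset.prod_congr rfl fun m _ => Real.exp_log (hpos m)

lemma Smat_apply {t : ℝ} (hpos : ∀ k, 0 < p k t) (z : ℂ) (l k : Fin n) :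
    Smat p z t l k = z ^ l.val * weight p l t * rootU k ^ l.val := by
  rw [Smat, Adiag, weight_eq hpos]
  push_cast
  ring

lemma Smat_eq {t : ℝ} (hpos : ∀ k, 0 < p k t) (z : ℂ) :
    Smat p z t = Matrix.diagonal (fun l : Fin n => z ^ l.val * (weight p l t : ℂ)) * dft n := by
  ext l k
  rw [Matrix.diagonal_mul, Smat_apply hpos, dft]

/-- The inverse of the transforming matrix. -/
lemma inv_mul_Smat {t : ℝ} (hpos : ∀ k, 0 < p k t) {z : ℂ} (hz : z ≠ 0) :
    (dftInv n * Matrix.diagonal (fun l : Fin n => (z ^ l.val * (weight p l t : ℂ))⁻¹)) *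
      Smat p z t = 1 := by
  rw [Smat_eq hpos, Matrix.mul_assoc, ← Matrix.mul_assoc (Matrix.diagonal _),
    Matrix.diagonal_mul_diagonal]
  have : (fun l : Fin n => (z ^ l.val * (weight p l t : ℂ))⁻¹ * (z ^ l.val * (weight p l t : ℂ))) =
      1 := by
    funext l
    exact inv_mul_cancel₀ (mul_ne_zero (pow_ne_zero _ hz) (weight_ne_zero l t))
  rw [this, Matrix.diagonal_one', Matrix.one_mul, dftInv_mul_dft]

lemma isUnit_Smat {t : ℝ} (hpos : ∀ k, 0 < p k t) {z : ℂ} (hz : z ≠ 0) : IsUnit (Smat p z t) :=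
  .of_mul_eq_one_right _ (inv_mul_Smat hpos hz)

lemma Smat_inv {t : ℝ} (hpos : ∀ k, 0 < p k t) {z : ℂ} (hz : z ≠ 0) : (Smat p z t)⁻¹ =
    dftInv n * Matrix.diagonal (fun l : Fin n => (z ^ l.val * (weight p l t : ℂ))⁻¹) :=
  Matrix.inv_eq_left_inv (inv_mul_Smat hpos hz)

lemma prod_filter_lt_succ {M : Type*} [CommMonoid M] (f : Fin n → M) {a b : Fin n}
    (h : b.val = a.val + 1) :
    ∏ m with m < b, f m = f a * ∏ m with m < a, f m := by
  have : (Finset.univ.filter fun m : Fin n => m < b) =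
      insert a (Finset.univ.filter fun m : Fin n => m < a) := by
    ext m
    simp only [Finset.mem_filter, Finset.mem_univ, true_and, Finset.mem_insert, Fin.lt_def,
      Fin.ext_iff]
    omega
  rw [this, Finset.prod_insert (by simp)]

lemma prod_univ_eq_last {M : Type*} [CommMonoid M] (f : Fin n → M) {a : Fin n}
    (h : a.val + 1 = n) : ∏ m, f m = f a * ∏ m with m < a, f m := by
  have : (Finset.univ : Finset (Fin n)) = insert a (Finset.univ.filter fun m : Fin n => m < a) := by
    ext m
    have := m.2
    simp only [Finset.mem_filter, Finset.mem_univ, true_and, Finset.mem_insert, Fin.lt_def,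
      Fin.ext_iff, true_iff]
    omega
  conv_lhs => rw [this]
  rw [Finset.prod_insert (by simp)]

/-- The columns of `Smat` are eigenvectors of the leading part. -/
lemma Dmat0_mul_Smat (hn : n ≠ 0) {t : ℝ} (hpos : ∀ k, 0 < p k t) (z : ℂ) :
    Dmat0 p z t * Smat p z t = Smat p z t * Matrix.diagonal (Adiag p z t) := by
  ext a j
  rw [Matrix.mul_diagonal, Matrix.mul_apply]
  have hpa : (p a t : ℂ) ≠ 0 := by exact_mod_cast (hpos a).ne'
  rcases Nat.lt_or_ge (a.val + 1) n with ha | ha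
  · rw [Finset.sum_eq_single_of_mem (⟨a.val + 1, ha⟩ : Fin n) (Finset.mem_univ _)]
    · rw [Dmat0, if_pos rfl, Smat, Smat, prod_filter_lt_succ _ (a := a) rfl]
      field_simp
      ring
    · intro b _ hb
      rw [Dmat0, if_neg (fun h => hb (Fin.ext h)), if_neg (fun h => by omega), zero_mul]
  · have hlast : a.val + 1 = n := by have := a.2; omega
    rw [Finset.sum_eq_single_of_mem (⟨0, by omega⟩ : Fin n) (Finset.mem_univ _)]
    · rw [Dmat0, if_neg (by simp), if_pos ⟨hlast, rfl⟩, Smat, Smat]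
      have hpow : Adiag p z t j ^ a.val * Adiag p z t j = z ^ n * ∏ m, (p m t : ℂ) := by
        rw [← pow_succ, hlast, Adiag, mul_pow, mul_pow, rootU_pow_card, mul_one,
          ← Complex.ofReal_pow, geomMean_pow hn hpos, Complex.ofReal_prod]
      rw [mul_right_comm (Adiag p z t j ^ a.val), hpow, prod_univ_eq_last _ hlast]
      have hne : ∏ m with m < a, (p m t : ℂ) ≠ 0 :=
        Finset.prod_ne_zero_iff.2 fun m _ => by exact_mod_cast (hpos m).ne'
      have hemp : (Finset.univ.filter fun m : Fin n => m < ⟨0, by omega⟩) = ∅ := by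
        ext m; simp [Fin.lt_def]
      rw [hemp, Finset.prod_empty, Finset.prod_inv_distrib, pow_zero]
      field_simp
    · intro b _ hb
      rw [Dmat0, if_neg (fun h => by have := b.2; omega),
        if_neg (fun h => hb (Fin.ext h.2)), zero_mul]

lemma Smat_conj_Dmat0 (hn : n ≠ 0) {t : ℝ} (hpos : ∀ k, 0 < p k t) {z : ℂ} (hz : z ≠ 0) :
    (Smat p z t)⁻¹ * Dmat0 p z t * Smat p z t = Matrix.diagonal (Adiag p z t) := by
  rw [Matrix.mul_assoc, Dmat0_mul_Smat hn hpos, ← Matrix.mul_assoc, Smat_inv hpos hz,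
    inv_mul_Smat hpos hz, Matrix.one_mul]

end Weights

/-! ### Decomposition of the transformed coefficient -/

section Decomposition

variable {n : ℕ}

/-- The defect in `(z + ζ)^n ≈ z^n + n ζ z^{n-1}`, relative to `z^{n-1}`. -/
def binomDefect (n : ℕ) (ζ z : ℂ) : ℂ := ((z + ζ) ^ n - z ^ n) / z ^ (n - 1) - n * ζ

/-- The limit, as `z → ∞`, of the perturbation of the leading part, before the Fourier
conjugation. -/
def leadCoef (p p' : Fin n → ℝ → ℝ) (q : Fin n → Fin n → ℝ → ℂ) (ζ : ℂ) (t : ℝ) :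
    Matrix (Fin n) (Fin n) ℂ := fun a b =>
  (if a.val + 1 = n ∧ b.val = 0 then n * ζ * geomMean p t else 0) -
    if a = b then q a a t + logWeightDeriv p p' a t else 0

/-- The part of the perturbation that vanishes as `z → ∞`, before the Fourier conjugation. -/
def remCoef (p : Fin n → ℝ → ℝ) (q : Fin n → Fin n → ℝ → ℂ) (ζ z : ℂ) (t : ℝ) :
    Matrix (Fin n) (Fin n) ℂ := fun a b =>
  (if a.val + 1 = n ∧ b.val = 0 then binomDefect n ζ z * geomMean p t else 0) -
    if b < a then (z ^ a.val)⁻¹ * z ^ b.val *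
      ((weight p a t : ℂ)⁻¹ * weight p b t * q a b t) else 0

/-- The limiting perturbation of the diagonal system. -/
def leadPert (p p' : Fin n → ℝ → ℝ) (q : Fin n → Fin n → ℝ → ℂ) (ζ : ℂ) (t : ℝ) :
    Matrix (Fin n) (Fin n) ℂ := dftInv n * leadCoef p p' q ζ t * dft n

/-- The vanishing perturbation of the diagonal system. -/
def remPert (p : Fin n → ℝ → ℝ) (q : Fin n → Fin n → ℝ → ℂ) (ζ z : ℂ) (t : ℝ) :
    Matrix (Fin n) (Fin n) ℂ := dftInv n * remCoef p q ζ z t * dft n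

lemma tendsto_binomDefect (hn : n ≠ 0) (ζ : ℂ) :
    Tendsto (binomDefect n ζ) (cobounded ℂ) (𝓝 0) := by
  -- With `u = 1/z` the quotient is the slope of `u ↦ (1 + ζ u)^n` at zero.
  have hd : HasDerivAt (fun u : ℂ => (1 + ζ * u) ^ n) (n * ζ) 0 := by
    have h := (((hasDerivAt_id (0 : ℂ)).const_mul ζ).const_add 1).fun_pow n
    simpa using h
  have h := (hasDerivAt_iff_tendsto_slope.1 hd).comp (tendsto_inv₀_cobounded' (α := ℂ))
  have h2 := h.sub_const (n * ζ)
  rw [sub_self] at h2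
  refine h2.congr' ?_
  filter_upwards [eventually_ne_cobounded (0 : ℂ)] with z hz
  have h3 : 1 + ζ * z⁻¹ = (z + ζ) / z := by field_simp
  simp only [Function.comp_apply, slope_def_field, mul_zero, add_zero, one_pow, sub_zero,
    binomDefect, h3]
  obtain ⟨m, rfl⟩ := Nat.exists_eq_succ_of_ne_zero hn
  rw [div_pow, Nat.succ_sub_one]
  simp only [Nat.succ_eq_add_one, pow_succ]
  field_simp

lemma weight_inv_mul_last {p : Fin n → ℝ → ℝ} {t : ℝ} (hpos : ∀ k, 0 < p k t) {a b : Fin n}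
    (ha : a.val + 1 = n) (hb : b.val = 0) :
    (weight p a t : ℂ)⁻¹ * weight p b t * p a t = geomMean p t := by
  have hne : (geomMean p t : ℂ) ≠ 0 := by exact_mod_cast (geomMean_pos hpos).ne'
  have hb1 : weight p b t = 1 := by
    have hemp : (Finset.univ.filter fun m : Fin n => m < b) = ∅ := by
      ext m; simp [Fin.lt_def, hb]
    rw [weight_eq hpos, hb, hemp, pow_zero, Finset.prod_empty, one_mul]
  have hprod : geomMean p t ^ a.val * geomMean p t = p a t * ∏ m with m < a, p m t := by
    rw [← pow_succ, ha, geomMean_pow (by omega) hpos, prod_univ_eq_last _ ha]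
  have hPne : (∏ m with m < a, (p m t : ℂ)) ≠ 0 :=
    Finset.prod_ne_zero_iff.2 fun m _ => by exact_mod_cast (hpos m).ne'
  have hprod' : (geomMean p t : ℂ) ^ a.val * geomMean p t =
      p a t * ∏ m with m < a, (p m t : ℂ) := by exact_mod_cast hprod
  rw [hb1, weight_eq hpos, Finset.prod_inv_distrib]
  push_cast
  rw [mul_inv, inv_inv, mul_one, mul_assoc, mul_comm _ (p a t : ℂ), ← hprod']
  field_simp

/-- Conjugation of the perturbation by the diagonal factor of `Smat`. -/
lemma diag_conj_sub {p p' : Fin n → ℝ → ℝ} {q : Fin n → Fin n → ℝ → ℂ} (hn : 2 ≤ n) {t : ℝ}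
    (hpos : ∀ k, 0 < p k t) (ζ : ℂ) {z : ℂ} (hz : z ≠ 0) :
    Matrix.diagonal (fun l : Fin n => (z ^ l.val * (weight p l t : ℂ))⁻¹) *
      (Dmat p q ζ z t - Dmat0 p z t) *
      Matrix.diagonal (fun l : Fin n => z ^ l.val * (weight p l t : ℂ)) -
      Matrix.diagonal (fun l => (logWeightDeriv p p' l t : ℂ)) =
    leadCoef p p' q ζ t + remCoef p q ζ z t := by
  ext a b
  rw [Matrix.sub_apply, Matrix.mul_diagonal, Matrix.diagonal_mul, Matrix.add_apply,
    Matrix.sub_apply, Matrix.diagonal_apply]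
  have hza : z ^ a.val ≠ 0 := pow_ne_zero _ hz
  have hwa := weight_ne_zero (p := p) a t
  by_cases hcorner : a.val + 1 = n ∧ b.val = 0
  · have hlt : b < a := by rw [Fin.lt_def]; omega
    have hab : a ≠ b := fun h => hlt.ne h.symm
    have hns : ¬ b.val = a.val + 1 := by omega
    have hD : Dmat p q ζ z t a b = (z + ζ) ^ n * p a t - q a b t := by
      rw [Dmat, if_neg hns, if_pos hcorner]
    have hD0 : Dmat0 p z t a b = z ^ n * p a t := by rw [Dmat0, if_neg hns, if_pos hcorner]
    rw [hD, hD0, leadCoef, remCoef, if_pos hcorner, if_pos hcorner, if_neg hab, if_neg hab,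
      if_pos hlt, binomDefect, ← weight_inv_mul_last hpos hcorner.1 hcorner.2, hcorner.2, pow_zero,
      show n - 1 = a.val by omega]
    field_simp
    ring
  · rw [leadCoef, remCoef, if_neg hcorner, if_neg hcorner, Dmat, Dmat0]
    by_cases hsucc : b.val = a.val + 1
    · have hlt : ¬ b < a := by rw [Fin.lt_def]; omega
      have hab : a ≠ b := fun h => by subst h; omega
      rw [if_pos hsucc, if_pos hsucc, if_neg hab, if_neg hab, if_neg hlt]
      ring
    · rw [if_neg hsucc, if_neg hsucc, if_neg hcorner, if_neg hcorner]
      rcases lt_trichotomy b a with hlt | heq | hgt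
      · have hab : a ≠ b := fun h => hlt.ne h.symm
        have hcond : a.val + 1 < b.val + n ∧ b ≤ a := by
          have := a.2
          rw [Fin.lt_def] at hlt
          exact ⟨by omega, hlt.le⟩
        rw [if_pos hcond, if_neg hab, if_neg hab, if_pos hlt]
        field_simp
        ring
      · subst heq
        have hcond : b.val + 1 < b.val + n ∧ b ≤ b := ⟨by omega, le_rfl⟩
        rw [if_pos hcond, if_pos rfl, if_pos rfl, if_neg (lt_irrefl b)]
        field_simp
        ring
      · rw [if_neg fun h => absurd h.2 (not_le.2 hgt), if_neg hgt.ne, if_neg hgt.ne,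
          if_neg hgt.not_gt]
        ring

/-- Almost everywhere the entries of `Smat` are differentiable, with an exceptional set that does
not depend on the parameter. -/
lemma ae_Sdot_eq {p p' : Fin n → ℝ → ℝ} (hp : ∀ k, HasW11Deriv (p k) (p' k))
    (hpos : ∀ k, ∀ t ∈ Icc (0 : ℝ) 1, 0 < p k t) : ∀ᵐ t, t ∈ Icc (0 : ℝ) 1 → ∀ z : ℂ,
      Sdot p z t = Matrix.diagonal (fun l => (logWeightDeriv p p' l t : ℂ)) * Smat p z t := by
  filter_upwards [ae_all_iff.2 fun a => (hasW11Deriv_logWeight hp hpos a).ae_hasDerivAt]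
    with t ht hmem z
  ext l k
  obtain ⟨hIoo, hd⟩ := ht l hmem
  have h1 := ((hd.exp.ofReal_comp).const_mul (z ^ l.val)).mul_const (rootU k ^ l.val)
  have h2 : (fun s => Smat p z s l k) =ᶠ[𝓝 t]
      fun s => z ^ l.val * ((Real.exp (logWeight p l s) : ℝ) : ℂ) * rootU k ^ l.val := by
    filter_upwards [Ioo_mem_nhds hIoo.1 hIoo.2] with s hs
    exact Smat_apply (fun k => hpos k s ⟨hs.1.le, hs.2.le⟩) z l k
  rw [Matrix.diagonal_mul, Sdot, h2.deriv_eq, h1.deriv, Smat_apply (fun k => hpos k t hmem), weight]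
  push_cast
  ring

/-- The transformed coefficient is diagonal up to a fixed summable matrix function and a
vanishing one. -/
lemma ae_transformed_eq {p p' : Fin n → ℝ → ℝ} {q : Fin n → Fin n → ℝ → ℂ} (hn : 2 ≤ n)
    (hp : ∀ k, HasW11Deriv (p k) (p' k))
    (hpos : ∀ k, ∀ t ∈ Icc (0 : ℝ) 1, 0 < p k t) (ζ : ℂ) :
    ∀ᵐ t, t ∈ Icc (0 : ℝ) 1 → ∀ z : ℂ, z ≠ 0 → transformed p q ζ z t =
      Matrix.toEuclideanCLM (n := Fin n) (𝕜 := ℂ)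
        (Matrix.diagonal (Adiag p z t) + leadPert p p' q ζ t + remPert p q ζ z t) := by
  filter_upwards [ae_Sdot_eq hp hpos] with t ht hmem z hz
  have hpt := fun k => hpos k t hmem
  rw [transformed, ht hmem z]
  congr 1
  have h1 : Dmat p q ζ z t = Dmat0 p z t + (Dmat p q ζ z t - Dmat0 p z t) := by abel
  rw [h1, Matrix.mul_add, Matrix.add_mul, Smat_conj_Dmat0 (by omega) hpt hz, add_sub_assoc,
    add_assoc, leadPert, remPert, ← Matrix.add_mul, ← Matrix.mul_add,
    ← diag_conj_sub hn hpt ζ hz, Smat_inv hpt hz, Smat_eq hpt]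
  have hL : Matrix.diagonal (fun l : Fin n => (z ^ l.val * (weight p l t : ℂ))⁻¹) *
      (Matrix.diagonal (fun l => (logWeightDeriv p p' l t : ℂ)) *
        Matrix.diagonal (fun l : Fin n => z ^ l.val * (weight p l t : ℂ))) =
      Matrix.diagonal (fun l => (logWeightDeriv p p' l t : ℂ)) := by
    rw [Matrix.diagonal_mul_diagonal, Matrix.diagonal_mul_diagonal]
    congr 1
    funext l
    rw [mul_comm (logWeightDeriv p p' l t : ℂ)]
    exact inv_mul_cancel_left₀ (mul_ne_zero (pow_ne_zero l.val hz) (weight_ne_zero l t)) _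
  congr 1
  generalize Dmat p q ζ z t - Dmat0 p z t = X
  conv_rhs => rw [Matrix.mul_sub, Matrix.sub_mul, ← hL]
  simp only [Matrix.mul_assoc]

lemma conj_apply (X : Matrix (Fin n) (Fin n) ℂ) (j k : Fin n) :
    (dftInv n * X * dft n) j k = ∑ a, ∑ b, dftInv n j a * dft n b k * X a b := by
  rw [Matrix.mul_apply, Finset.sum_comm]
  refine Finset.sum_congr rfl fun b _ => ?_
  rw [Matrix.mul_apply, Finset.sum_mul]
  exact Finset.sum_congr rfl fun a _ => by ring

lemma norm_conj_apply_le (X : Matrix (Fin n) (Fin n) ℂ) (j k : Fin n) :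
    ‖(dftInv n * X * dft n) j k‖ ≤ ∑ a, ∑ b, ‖X a b‖ := by
  rw [conj_apply]
  refine norm_sum_le_of_le _ fun a _ => norm_sum_le_of_le _ fun b _ => ?_
  have hn : (1 : ℝ) ≤ n := by
    exact_mod_cast Nat.one_le_iff_ne_zero.2 fun h => by subst h; exact j.elim0
  rw [norm_mul, norm_mul, dftInv, dft, norm_mul, norm_inv, norm_inv, norm_pow, norm_pow,
    norm_rootU, norm_rootU, Complex.norm_natCast]
  simp only [one_pow, inv_one, mul_one]
  exact mul_le_of_le_one_left (norm_nonneg _) (inv_le_one_of_one_le₀ hn)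

/-- The diagonal of the limiting perturbation. -/
lemma leadPert_diag {p p' : Fin n → ℝ → ℝ} {q : Fin n → Fin n → ℝ → ℂ} {ζ : ℂ} {t : ℝ} (j : Fin n) :
    leadPert p p' q ζ t j j = ζ * geomMean p t * rootU j -
      (n : ℂ)⁻¹ * ∑ a, (q a a t + logWeightDeriv p p' a t) := by
  have hn : 0 < n := Nat.pos_of_ne_zero fun h => by subst h; exact j.elim0
  have hnC : (n : ℂ) ≠ 0 := Nat.cast_ne_zero.2 hn.ne'
  rw [leadPert, conj_apply]
  simp only [leadCoef, mul_sub, Finset.sum_sub_distrib]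
  congr 1
  · rw [Finset.sum_eq_single_of_mem (⟨n - 1, by omega⟩ : Fin n) (Finset.mem_univ _),
      Finset.sum_eq_single_of_mem (⟨0, hn⟩ : Fin n) (Finset.mem_univ _)]
    · rw [if_pos ⟨by simp only; omega, rfl⟩, dftInv, dft]
      have h1 : rootU j ^ (n - 1) * rootU j = 1 := by
        rw [← pow_succ, Nat.sub_add_cancel hn, rootU_pow_card]
      have h2 : (rootU j ^ (n - 1))⁻¹ = rootU j := inv_eq_of_mul_eq_one_right h1
      simp only [pow_zero, mul_one]
      rw [h2]
      field_simp
    · intro b _ hb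
      rw [if_neg (fun h => hb (Fin.ext h.2)), mul_zero]
    · intro a _ ha
      refine Finset.sum_eq_zero fun b _ => ?_
      rw [if_neg (fun h => ha (Fin.ext (by simp only; omega))), mul_zero]
  · rw [Finset.mul_sum]
    refine Finset.sum_congr rfl fun a _ => ?_
    simp only [mul_ite, mul_zero, Finset.sum_ite_eq, Finset.mem_univ, if_true]
    rw [dftInv, dft, mul_assoc (n : ℂ)⁻¹, inv_mul_cancel₀ (pow_ne_zero _ (rootU_ne_zero j)), mul_one]

lemma integrableOn_geomMean {p p' : Fin n → ℝ → ℝ} (hp : ∀ k, HasW11Deriv (p k) (p' k))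
    (hpos : ∀ k, ∀ t ∈ Icc (0 : ℝ) 1, 0 < p k t) :
    IntegrableOn (fun t => (geomMean p t : ℂ)) (Icc 0 1) :=
  (Complex.continuous_ofReal.comp_continuousOn (continuousOn_geomMean hp hpos)).integrableOn_Icc

lemma integrableOn_conj {X : ℝ → Matrix (Fin n) (Fin n) ℂ}
    (hX : ∀ a b, IntegrableOn (fun t => X t a b) (Icc 0 1)) (j k : Fin n) :
    IntegrableOn (fun t => (dftInv n * X t * dft n) j k) (Icc 0 1) := by
  simp only [conj_apply]
  exact integrable_finsetSum _ fun a _ => integrable_finsetSum _ fun b _ =>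
    (hX a b).const_mul _

lemma integrableOn_leadPert {p p' : Fin n → ℝ → ℝ} {q : Fin n → Fin n → ℝ → ℂ}
    (hp : ∀ k, HasW11Deriv (p k) (p' k)) (hpos : ∀ k, ∀ t ∈ Icc (0 : ℝ) 1, 0 < p k t)
    (hq : ∀ k l, l ≤ k → IntegrableOn (q k l) (Icc 0 1)) (ζ : ℂ) (j k : Fin n) :
    IntegrableOn (fun t => leadPert p p' q ζ t j k) (Icc 0 1) := by
  refine integrableOn_conj (fun a b => ?_) j k
  simp only [leadCoef]
  refine Integrable.sub ?_ ?_
  · split_ifs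
    · exact (integrableOn_geomMean hp hpos).const_mul _
    · exact integrable_zero _ _ _
  · split_ifs
    · exact (hq a a le_rfl).add (hasW11Deriv_logWeight hp hpos a).ofReal.integrable
    · exact integrable_zero _ _ _

/-- The `z`-independent factor of an entry of `remCoef` below the diagonal. -/
def lowerCoef (p : Fin n → ℝ → ℝ) (q : Fin n → Fin n → ℝ → ℂ) (a b : Fin n) (t : ℝ) : ℂ :=
  if b < a then (weight p a t : ℂ)⁻¹ * weight p b t * q a b t else 0

lemma integrableOn_lowerCoef {p p' : Fin n → ℝ → ℝ} {q : Fin n → Fin n → ℝ → ℂ}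
    (hp : ∀ k, HasW11Deriv (p k) (p' k)) (hpos : ∀ k, ∀ t ∈ Icc (0 : ℝ) 1, 0 < p k t)
    (hq : ∀ k l, l ≤ k → IntegrableOn (q k l) (Icc 0 1)) (a b : Fin n) :
    IntegrableOn (lowerCoef p q a b) (Icc 0 1) := by
  have hw : ∀ a, ContinuousOn (fun t => (weight p a t : ℂ)) (Icc 0 1) := fun a =>
    Complex.continuous_ofReal.comp_continuousOn
      (Real.continuous_exp.comp_continuousOn (hasW11Deriv_logWeight hp hpos a).continuousOn)
  unfold lowerCoef
  split_ifs with h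
  · exact (hq a b h.le).continuousOn_mul
      (((hw a).inv₀ fun t _ => weight_ne_zero a t).mul (hw b)) isCompact_Icc
  · exact integrable_zero _ _ _

lemma remCoef_eq (p : Fin n → ℝ → ℝ) (q : Fin n → Fin n → ℝ → ℂ) (ζ z : ℂ) (t : ℝ) (a b : Fin n) :
    remCoef p q ζ z t a b =
      (if a.val + 1 = n ∧ b.val = 0 then binomDefect n ζ z * geomMean p t else 0) -
        (z ^ a.val)⁻¹ * z ^ b.val * lowerCoef p q a b t := by
  rw [remCoef, lowerCoef]
  split_ifs <;> simp

lemma integrableOn_remPert {p p' : Fin n → ℝ → ℝ} {q : Fin n → Fin n → ℝ → ℂ}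
    (hp : ∀ k, HasW11Deriv (p k) (p' k)) (hpos : ∀ k, ∀ t ∈ Icc (0 : ℝ) 1, 0 < p k t)
    (hq : ∀ k l, l ≤ k → IntegrableOn (q k l) (Icc 0 1)) (ζ z : ℂ) (j k : Fin n) :
    IntegrableOn (fun t => remPert p q ζ z t j k) (Icc 0 1) := by
  refine integrableOn_conj (fun a b => ?_) j k
  simp only [remCoef_eq]
  refine Integrable.sub ?_ ((integrableOn_lowerCoef hp hpos hq a b).const_mul _)
  split_ifs
  · exact (integrableOn_geomMean hp hpos).const_mul _
  · exact integrable_zero _ _ _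

/-- A summable function that dominates the vanishing perturbation up to a factor tending to
zero. -/
def remDom (p : Fin n → ℝ → ℝ) (q : Fin n → Fin n → ℝ → ℂ) (t : ℝ) : ℝ :=
  ∑ a, ∑ b, (|geomMean p t| + ‖lowerCoef p q a b t‖)

/-- The factor tending to zero in the bound of the vanishing perturbation. -/
def remSize (n : ℕ) (ζ z : ℂ) : ℝ := ‖binomDefect n ζ z‖ + ‖z‖⁻¹

lemma remDom_nonneg (p : Fin n → ℝ → ℝ) (q : Fin n → Fin n → ℝ → ℂ) (t : ℝ) :
    0 ≤ remDom p q t :=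
  Finset.sum_nonneg fun _ _ => Finset.sum_nonneg fun _ _ => by positivity

lemma integrableOn_remDom {p p' : Fin n → ℝ → ℝ} {q : Fin n → Fin n → ℝ → ℂ}
    (hp : ∀ k, HasW11Deriv (p k) (p' k)) (hpos : ∀ k, ∀ t ∈ Icc (0 : ℝ) 1, 0 < p k t)
    (hq : ∀ k l, l ≤ k → IntegrableOn (q k l) (Icc 0 1)) :
    IntegrableOn (remDom p q) (Icc 0 1) :=
  integrable_finsetSum _ fun a _ => integrable_finsetSum _ fun b _ =>
    ((continuousOn_geomMean hp hpos).abs.integrableOn_Icc).add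
      (integrableOn_lowerCoef hp hpos hq a b).norm

lemma tendsto_remSize (hn : n ≠ 0) (ζ : ℂ) : Tendsto (remSize n ζ) (cobounded ℂ) (𝓝 0) := by
  have h1 := (tendsto_binomDefect hn ζ).norm
  have h2 := (tendsto_inv₀_cobounded (α := ℂ)).norm
  have h3 := h1.add h2
  rw [norm_zero, add_zero] at h3
  exact h3.congr fun z => by rw [remSize, norm_inv]

lemma norm_remPert_le (p : Fin n → ℝ → ℝ) (q : Fin n → Fin n → ℝ → ℂ) (ζ : ℂ) {z : ℂ}
    (hz : 1 ≤ ‖z‖) (t : ℝ) (j k : Fin n) :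
    ‖remPert p q ζ z t j k‖ ≤ remSize n ζ z * remDom p q t := by
  refine (norm_conj_apply_le _ j k).trans ?_
  rw [remDom, Finset.mul_sum]
  refine Finset.sum_le_sum fun a _ => ?_
  rw [Finset.mul_sum]
  refine Finset.sum_le_sum fun b _ => ?_
  have hz0 : 0 < ‖z‖ := by linarith
  rw [remCoef_eq]
  refine (norm_sub_le _ _).trans ?_
  rw [mul_add]
  refine add_le_add ?_ ?_
  · split_ifs
    · rw [norm_mul, Complex.norm_real, Real.norm_eq_abs, remSize]
      exact mul_le_mul_of_nonneg_right (le_add_of_nonneg_right (by positivity)) (abs_nonneg _)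
    · rw [norm_zero, remSize]; positivity
  · by_cases hba : b < a
    · rw [norm_mul]
      refine mul_le_mul_of_nonneg_right ?_ (norm_nonneg _)
      have h1 : ‖(z ^ a.val)⁻¹ * z ^ b.val‖ ≤ ‖z‖⁻¹ := by
        rw [norm_mul, norm_inv, norm_pow, norm_pow, inv_mul_eq_div, div_le_iff₀ (by positivity)]
        rw [Fin.lt_def] at hba
        have h2 : ‖z‖ ^ (b.val + 1) ≤ ‖z‖ ^ a.val := pow_le_pow_right₀ hz hba
        rw [pow_succ] at h2
        rw [inv_mul_eq_div, le_div_iff₀ hz0]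
        exact h2
      exact h1.trans (le_add_of_nonneg_left (norm_nonneg _))
    · simp [lowerCoef, hba]

lemma differentiableAt_remPert (p : Fin n → ℝ → ℝ) (q : Fin n → Fin n → ℝ → ℂ) (ζ : ℂ) {z : ℂ}
    (hz : z ≠ 0) (t : ℝ) (j k : Fin n) :
    DifferentiableAt ℂ (fun z => remPert p q ζ z t j k) z := by
  simp only [remPert, conj_apply, remCoef_eq]
  refine DifferentiableAt.fun_sum fun a _ => DifferentiableAt.fun_sum fun b _ =>
    DifferentiableAt.const_mul (DifferentiableAt.sub ?_ ?_) _
  · split_ifs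
    · have : z ^ (n - 1) ≠ 0 := pow_ne_zero _ hz
      unfold binomDefect
      fun_prop (disch := assumption)
    · exact differentiableAt_const _
  · have : z ^ a.val ≠ 0 := pow_ne_zero _ hz
    fun_prop (disch := assumption)

end Decomposition

/-! ### Sectors -/

section Sectors

variable {n m : ℕ}

lemma exists_mem_sector (hn : n ≠ 0) (m : ℕ) {r : ℝ} (hr : 0 < r) : ∃ z ∈ sector n m, ‖z‖ = r := by
  have hn' : (0 : ℝ) < n := by exact_mod_cast Nat.pos_of_ne_zero hn
  refine ⟨_, ⟨r, Real.pi * ((m : ℝ) - 1 / 2) / n, hr, ?_, ?_, rfl⟩, ?_⟩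
  · gcongr; norm_num
  · gcongr; norm_num
  · rw [norm_mul, Complex.norm_exp_ofReal_mul_I, mul_one, Complex.norm_real, Real.norm_eq_abs,
      abs_of_pos hr]

lemma ne_zero_of_mem_sector {z : ℂ} (hz : z ∈ sector n m) : z ≠ 0 := by
  obtain ⟨r, θ, hr, -, -, rfl⟩ := hz
  exact mul_ne_zero (by exact_mod_cast hr.ne') (Complex.exp_ne_zero _)

/-- A sector is the image of a product of open intervals under the exponential map. -/
lemma isOpen_sector (n m : ℕ) : IsOpen (sector n m) := by
  have h : sector n m = Complex.exp ''
      {w : ℂ | Real.pi * ((m : ℝ) - 1) / n < w.im ∧ w.im < Real.pi * m / n} := by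
    ext z
    constructor
    · rintro ⟨r, θ, hr, h1, h2, rfl⟩
      refine ⟨(Real.log r : ℂ) + θ * Complex.I, by simpa using ⟨h1, h2⟩, ?_⟩
      rw [Complex.exp_add, ← Complex.ofReal_exp, Real.exp_log hr]
    · rintro ⟨w, ⟨h1, h2⟩, rfl⟩
      refine ⟨Real.exp w.re, w.im, Real.exp_pos _, h1, h2, ?_⟩
      rw [Complex.ofReal_exp, ← Complex.exp_add, Complex.re_add_im]
  rw [h]
  refine Complex.isOpenMap_exp _ ?_
  exact (isOpen_lt continuous_const Complex.continuous_im).inter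
    (isOpen_lt Complex.continuous_im continuous_const)

lemma re_mul_rootU_sub (r θ : ℝ) (j k : Fin n) :
    ((r * Complex.exp (θ * Complex.I)) * (rootU j - rootU k)).re =
      -2 * r * Real.sin (θ + Real.pi * ((j.val : ℝ) + k.val + 2) / n) *
        Real.sin (Real.pi * ((j.val : ℝ) - k.val) / n) := by
  have h : ∀ l : Fin n, ((r * Complex.exp (θ * Complex.I)) * rootU l).re =
      r * Real.cos (θ + 2 * Real.pi * ((l.val : ℝ) + 1) / n) := by
    intro l
    have h1 : (r * Complex.exp (θ * Complex.I)) * rootU l =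
        r * Complex.exp (((θ + 2 * Real.pi * ((l.val : ℝ) + 1) / n : ℝ) : ℂ) * Complex.I) := by
      rw [rootU, mul_assoc, ← Complex.exp_add]
      congr 2
      push_cast
      ring
    rw [h1, Complex.re_ofReal_mul, Complex.exp_ofReal_mul_I_re]
  rw [mul_sub, Complex.sub_re, h, h, ← mul_sub, Real.cos_sub_cos,
    show (θ + 2 * Real.pi * ((j.val : ℝ) + 1) / n + (θ + 2 * Real.pi * ((k.val : ℝ) + 1) / n)) / 2 =
      θ + Real.pi * ((j.val : ℝ) + k.val + 2) / n by ring,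
    show (θ + 2 * Real.pi * ((j.val : ℝ) + 1) / n - (θ + 2 * Real.pi * ((k.val : ℝ) + 1) / n)) / 2 =
      Real.pi * ((j.val : ℝ) - k.val) / n by ring]
  ring

/-- Between two consecutive multiples of `π/n` the sine has a constant sign. -/
lemma sin_sign (hn : n ≠ 0) (N : ℕ) {x : ℝ} (h1 : Real.pi * N / n < x)
    (h2 : x < Real.pi * (N + 1) / n) : 0 < (-1) ^ (N / n) * Real.sin x := by
  have hn' : (0 : ℝ) < n := by exact_mod_cast Nat.pos_of_ne_zero hn
  rw [← Real.sin_sub_nat_mul_pi]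
  rw [div_lt_iff₀ hn'] at h1
  rw [lt_div_iff₀ hn'] at h2
  have h3 : ((N / n : ℕ) : ℝ) * n ≤ N := by exact_mod_cast Nat.div_mul_le_self N n
  have h4 : (N : ℝ) + 1 ≤ ((N / n : ℕ) : ℝ) * n + n := by
    exact_mod_cast (Nat.lt_div_mul_add (Nat.pos_of_ne_zero hn) : N < N / n * n + n)
  refine Real.sin_pos_of_pos_of_lt_pi ?_ ?_
  · have : Real.pi * (((N / n : ℕ) : ℝ) * n) < x * n :=
      (mul_le_mul_of_nonneg_left h3 Real.pi_pos.le).trans_lt h1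
    rw [← mul_assoc] at this
    have := lt_of_mul_lt_mul_right this hn'.le
    linarith
  · have : x * n < Real.pi * (((N / n : ℕ) : ℝ) * n + n) :=
      h2.trans_le (mul_le_mul_of_nonneg_left h4 Real.pi_pos.le)
    rw [show Real.pi * (((N / n : ℕ) : ℝ) * n + n) = (Real.pi * ((N / n : ℕ) : ℝ) + Real.pi) * n by
      ring] at this
    have := lt_of_mul_lt_mul_right this hn'.le
    linarith

/-- The order of the numbers `Re z ω_j` is the same for all `z` of a sector: it can change only
across the rays `Arg z ∈ (π/n) ℤ`. -/
lemma re_nonpos_of_mem_sector {z w : ℂ} (hz : z ∈ sector n m) (hw : w ∈ sector n m)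
    {j k : Fin n} (h : (w * (rootU j - rootU k)).re ≤ 0) : (z * (rootU j - rootU k)).re ≤ 0 := by
  have hn : n ≠ 0 := fun h => by subst h; exact k.elim0
  have hn' : (0 : ℝ) < n := by exact_mod_cast Nat.pos_of_ne_zero hn
  have key : ∀ θ : ℝ, Real.pi * ((m : ℝ) - 1) / n < θ → θ < Real.pi * m / n →
      0 < (-1) ^ ((m + j.val + k.val + 1) / n) *
        Real.sin (θ + Real.pi * ((j.val : ℝ) + k.val + 2) / n) := by
    intro θ h1 h2
    refine sin_sign hn _ ?_ ?_
    · push_cast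
      have : Real.pi * ((m : ℝ) + j.val + k.val + 1) / n =
          Real.pi * ((m : ℝ) - 1) / n + Real.pi * ((j.val : ℝ) + k.val + 2) / n := by ring
      linarith
    · push_cast
      have : Real.pi * ((m : ℝ) + j.val + k.val + 1 + 1) / n =
          Real.pi * m / n + Real.pi * ((j.val : ℝ) + k.val + 2) / n := by ring
      linarith
  obtain ⟨r, θ, hr, h1, h2, rfl⟩ := hz
  obtain ⟨r', θ', hr', h1', h2', rfl⟩ := hw
  rw [re_mul_rootU_sub] at h ⊢
  have k1 := key θ h1 h2
  have k2 := key θ' h1' h2'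
  set e : ℝ := (-1) ^ ((m + j.val + k.val + 1) / n)
  set s : ℝ := Real.sin (Real.pi * ((j.val : ℝ) - k.val) / n)
  have he : e * e = 1 := by
    rw [← pow_add, ← two_mul, pow_mul]; norm_num
  have hes : 0 ≤ e * s := by
    by_contra hcon
    have h5 := mul_neg_of_pos_of_neg (mul_pos hr' k2) (not_le.1 hcon)
    have h6 : r' * (e * Real.sin (θ' + Real.pi * ((j.val : ℝ) + k.val + 2) / n)) * (e * s) =
      (e * e) * (r' * Real.sin (θ' + Real.pi * ((j.val : ℝ) + k.val + 2) / n) * s) := by ring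
    rw [h6, he, one_mul] at h5
    linarith
  have h5 := mul_nonneg (mul_pos hr k1).le hes
  have h6 : r * (e * Real.sin (θ + Real.pi * ((j.val : ℝ) + k.val + 2) / n)) * (e * s) =
    (e * e) * (r * Real.sin (θ + Real.pi * ((j.val : ℝ) + k.val + 2) / n) * s) := by ring
  rw [h6, he, one_mul] at h5
  linarith

lemma sector_sign (j k : Fin n) : (∀ z ∈ sector n m, (z * (rootU j - rootU k)).re ≤ 0) ∨
    (∀ z ∈ sector n m, 0 ≤ (z * (rootU j - rootU k)).re) := by
  by_cases h : ∀ z ∈ sector n m, (z * (rootU j - rootU k)).re ≤ 0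
  · exact Or.inl h
  · right
    push Not at h
    obtain ⟨w, hw, hpos⟩ := h
    intro z hz
    have h1 : (w * (rootU k - rootU j)).re ≤ 0 := by
      rw [← neg_sub, mul_neg, Complex.neg_re]; linarith
    have h2 := re_nonpos_of_mem_sector hz hw h1
    rw [← neg_sub, mul_neg, Complex.neg_re] at h2
    linarith

lemma exists_perm_ordered (hn : n ≠ 0) (m : ℕ) : ∃ τ : Equiv.Perm (Fin n), ∀ z ∈ sector n m,
    ∀ k l, k < l → (z * (rootU (τ k) - rootU (τ l))).re ≤ 0 := by
  obtain ⟨w, hw, -⟩ := exists_mem_sector hn m one_pos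
  refine ⟨Tuple.sort fun j => (w * rootU j).re, fun z hz k l hkl =>
    re_nonpos_of_mem_sector hz hw ?_⟩
  have h := Tuple.monotone_sort (fun j : Fin n => (w * rootU j).re) hkl.le
  rw [mul_sub, Complex.sub_re]
  exact sub_nonpos.2 h

end Sectors

/-! ### The diagonal representation -/

section Representation

variable {n : ℕ}

lemma coordProj_apply (j i : Fin n) (x : EuclideanSpace ℂ (Fin n)) :
    coordProj j x i = if i = j then x i else 0 := by
  change (Matrix.diagonal (fun l => if l = j then (1 : ℂ) else 0)).mulVec x.ofLp i = _
  rw [Matrix.mulVec_diagonal]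
  split_ifs <;> simp

lemma isCompleteProjSystem_coordProj (τ : Equiv.Perm (Fin n)) :
    IsCompleteProjSystem fun k => coordProj (τ k) where
  symmetricProjection k := by
    refine ⟨?_, fun x y => ?_⟩
    · refine LinearMap.ext fun x => ?_
      ext i
      change coordProj (τ k) (coordProj (τ k) x) i = coordProj (τ k) x i
      rw [coordProj_apply, coordProj_apply]
      split_ifs <;> rfl
    · change inner ℂ (coordProj (τ k) x) y = inner ℂ x (coordProj (τ k) y)
      rw [PiLp.inner_apply, PiLp.inner_apply]
      refine Finset.sum_congr rfl fun i _ => ?_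
      rw [coordProj_apply, coordProj_apply]
      split_ifs <;> simp
  ne_zero k h := by
    have h1 := congrArg (fun x : EuclideanSpace ℂ (Fin n) => x (τ k))
      (DFunLike.congr_fun h (EuclideanSpace.single (τ k) (1 : ℂ)))
    simp [coordProj_apply] at h1
  orthogonal k l hkl := by
    ext x i
    change coordProj (τ k) (coordProj (τ l) x) i = 0
    rw [coordProj_apply, coordProj_apply]
    split_ifs with h1 h2
    · exact absurd (τ.injective (h1.symm.trans h2)) hkl
    · rfl
    · rfl
  sum_eq_one := by
    rw [Equiv.sum_comp τ fun j => coordProj j]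
    ext x i
    simp [coordProj_apply]

lemma map_matrix_eq_sum {E : Type*} [AddCommGroup E] [Module ℂ E]
    (L : Matrix (Fin n) (Fin n) ℂ →ₗ[ℂ] E) (A : Matrix (Fin n) (Fin n) ℂ) :
    L A = ∑ i, ∑ j, A i j • L (Matrix.single i j 1) := by
  conv_lhs => rw [Matrix.matrix_eq_sum_single A]
  rw [map_sum]
  refine Finset.sum_congr rfl fun i _ => ?_
  rw [map_sum]
  refine Finset.sum_congr rfl fun j _ => ?_
  rw [← map_smul, Matrix.smul_single, smul_eq_mul, mul_one]

lemma sum_smul_map_diagonal {E : Type*} [AddCommGroup E] [Module ℂ E]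
    (L : Matrix (Fin n) (Fin n) ℂ →ₗ[ℂ] E) (τ : Equiv.Perm (Fin n)) (a : Fin n → ℂ) :
    ∑ k, a (τ k) • L (Matrix.diagonal fun l => if l = τ k then 1 else 0) =
      L (Matrix.diagonal a) := by
  rw [Equiv.sum_comp τ fun j => a j • L (Matrix.diagonal fun l => if l = j then 1 else 0)]
  simp only [← map_smul]
  rw [← map_sum]
  congr 1
  ext i j
  rw [Matrix.sum_apply]
  simp [Matrix.diagonal_apply]

lemma integrableOn_map_matrix {E : Type*} [NormedAddCommGroup E] [NormedSpace ℂ E]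
    (L : Matrix (Fin n) (Fin n) ℂ →ₗ[ℂ] E) {A : ℝ → Matrix (Fin n) (Fin n) ℂ}
    (hA : ∀ i j, IntegrableOn (fun t => A t i j) (Icc 0 1)) :
    IntegrableOn (fun t => L (A t)) (Icc 0 1) := by
  rw [show (fun t => L (A t)) = fun t => ∑ i, ∑ j, A t i j • L (Matrix.single i j 1) from
    funext fun t => map_matrix_eq_sum L (A t)]
  exact integrable_finsetSum _ fun i _ => integrable_finsetSum _ fun j _ => (hA i j).smul_const _

lemma memW11Ball_of_hasW11Deriv {E : Type*} [NormedAddCommGroup E] [NormedSpace ℝ E]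
    {f f' : ℝ → E} (hf : HasW11Deriv f f') :
    MemW11Ball (∫ t in (0 : ℝ)..1, (‖f t‖ + ‖f' t‖)) f := ⟨f', hf, le_rfl⟩

/-- The perturbations for large `z`, realized in a normed space by `L`, are approximated in `L_1` by a
single `W_1^1` function vanishing at the endpoints. -/
lemma exists_approx_pert {E : Type*} [NormedAddCommGroup E] [NormedSpace ℂ E] [CompleteSpace E]
    (L : Matrix (Fin n) (Fin n) ℂ →ₗ[ℂ] E) {p p' : Fin n → ℝ → ℝ}
    {q : Fin n → Fin n → ℝ → ℂ} (hn : n ≠ 0)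
    (hp : ∀ k, HasW11Deriv (p k) (p' k)) (hpos : ∀ k, ∀ t ∈ Icc (0 : ℝ) 1, 0 < p k t)
    (hq : ∀ k l, l ≤ k → IntegrableOn (q k l) (Icc 0 1)) (ζ : ℂ) {ε : ℝ} (hε : 0 < ε) :
    ∃ C C' : ℝ → E,
      HasW11Deriv C C' ∧ C 0 = 0 ∧ C 1 = 0 ∧ ∀ᶠ z in cobounded ℂ,
        ∫ t in (0 : ℝ)..1, ‖L (leadPert p p' q ζ t + remPert p q ζ z t) - C t‖ ≤ ε := by
  set s : ℝ := ∑ i : Fin n, ∑ j : Fin n, ‖L (Matrix.single i j 1)‖ with hs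
  have hs0 : 0 ≤ s := Finset.sum_nonneg fun i _ => Finset.sum_nonneg fun j _ => norm_nonneg _
  set δ : ℝ := ε / (2 * (s + 1)) with hδ
  have hδ0 : 0 < δ := by positivity
  have hB := integrableOn_leadPert hp hpos hq ζ
  choose χ hχ hχ0 hχ1 happ using fun i j => exists_contDiff_integral_sub_le (hB i j) hδ0
  have hχi : ∀ i j, IntegrableOn (χ i j) (Icc 0 1) := fun i j =>
    (hχ i j).continuous.continuousOn.integrableOn_Icc
  have hBχ : ∀ i j, IntegrableOn (fun t => leadPert p p' q ζ t i j - χ i j t) (Icc 0 1) :=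
    fun i j => (hB i j).sub (hχi i j)
  set P : ℝ := ∫ t in (0 : ℝ)..1, remDom p q t with hP
  have hP0 : 0 ≤ P := intervalIntegral.integral_nonneg zero_le_one fun t _ => remDom_nonneg p q t
  refine ⟨fun t => ∑ i, ∑ j, χ i j t • L (Matrix.single i j 1),
    fun t => ∑ i, ∑ j, deriv (χ i j) t • L (Matrix.single i j 1), ?_,
    by simp [hχ0], by simp [hχ1], ?_⟩
  · refine HasW11Deriv.sum _ fun i _ => HasW11Deriv.sum _ fun j _ => ?_
    exact (HasW11Deriv.of_contDiff (hχ i j)).clm_comp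
      ((ContinuousLinearMap.toSpanSingleton ℂ (L (Matrix.single i j 1))).restrictScalars ℝ)
  filter_upwards [(tendsto_remSize hn ζ).eventually_le_const
    (show 0 < δ / (P + 1) by positivity),
    tendsto_norm_cobounded_atTop.eventually_ge_atTop (1 : ℝ)] with z hz hz1
  have hR := integrableOn_remPert hp hpos hq ζ z
  have h1 : ∀ i j, IntervalIntegrable (fun t => ‖leadPert p p' q ζ t i j - χ i j t‖)
      volume 0 1 := fun i j =>
    (intervalIntegrable_of_integrableOn_Icc (hBχ i j) (by simp) (by simp)).norm
  have h2 : IntervalIntegrable (fun t => δ / (P + 1) * remDom p q t) volume 0 1 :=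
    (intervalIntegrable_of_integrableOn_Icc (integrableOn_remDom hp hpos hq)
      (by simp) (by simp)).const_mul _
  have h3 : ∀ i j, IntervalIntegrable (fun t => (‖leadPert p p' q ζ t i j - χ i j t‖ +
      δ / (P + 1) * remDom p q t) * ‖L (Matrix.single i j 1)‖) volume 0 1 := fun i j =>
    ((h1 i j).add h2).mul_const _
  have h4 : IntegrableOn (fun t => L (leadPert p p' q ζ t + remPert p q ζ z t) -
      ∑ i, ∑ j, χ i j t • L (Matrix.single i j 1)) (Icc 0 1) :=
    (integrableOn_map_matrix L fun i j => (hB i j).add (hR i j)).sub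
      (integrable_finsetSum _ fun i _ => integrable_finsetSum _ fun j _ => (hχi i j).smul_const _)
  have h3' : ∀ i, IntervalIntegrable (fun t => ∑ j, (‖leadPert p p' q ζ t i j - χ i j t‖ +
      δ / (P + 1) * remDom p q t) * ‖L (Matrix.single i j 1)‖) volume 0 1 := fun i => by
    simpa only [Finset.sum_fn] using
      IntervalIntegrable.sum Finset.univ fun j _ => h3 i j
  have hsum : IntervalIntegrable (fun t => ∑ i, ∑ j, (‖leadPert p p' q ζ t i j - χ i j t‖ +
      δ / (P + 1) * remDom p q t) * ‖L (Matrix.single i j 1)‖) volume 0 1 := by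
    simpa only [Finset.sum_fn] using
      IntervalIntegrable.sum Finset.univ fun i _ => h3' i
  calc ∫ t in (0 : ℝ)..1, ‖L (leadPert p p' q ζ t + remPert p q ζ z t) -
        ∑ i, ∑ j, χ i j t • L (Matrix.single i j 1)‖
      ≤ ∫ t in (0 : ℝ)..1, ∑ i, ∑ j, (‖leadPert p p' q ζ t i j - χ i j t‖ +
          δ / (P + 1) * remDom p q t) * ‖L (Matrix.single i j 1)‖ := by
        refine intervalIntegral.integral_mono_on zero_le_one
          (intervalIntegrable_of_integrableOn_Icc h4 (by simp) (by simp)).norm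
          hsum
          fun t _ => ?_
        rw [map_matrix_eq_sum L, ← Finset.sum_sub_distrib]
        refine norm_sum_le_of_le _ fun i _ => ?_
        rw [← Finset.sum_sub_distrib]
        refine norm_sum_le_of_le _ fun j _ => ?_
        rw [← sub_smul, norm_smul, Matrix.add_apply, add_sub_right_comm]
        refine mul_le_mul_of_nonneg_right ((norm_add_le _ _).trans (add_le_add le_rfl ?_))
          (norm_nonneg _)
        exact (norm_remPert_le p q ζ hz1 t i j).trans
          (mul_le_mul_of_nonneg_right hz (remDom_nonneg p q t))
    _ = ∑ i, ∑ j, ((∫ t in (0 : ℝ)..1, ‖leadPert p p' q ζ t i j - χ i j t‖) +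
          δ / (P + 1) * P) * ‖L (Matrix.single i j 1)‖ := by
        rw [intervalIntegral.integral_finsetSum fun i _ => h3' i]
        refine Finset.sum_congr rfl fun i _ => ?_
        rw [intervalIntegral.integral_finsetSum fun j _ => h3 i j]
        refine Finset.sum_congr rfl fun j _ => ?_
        rw [intervalIntegral.integral_mul_const, intervalIntegral.integral_add (h1 i j) h2,
          intervalIntegral.integral_const_mul]
    _ ≤ ∑ i : Fin n, ∑ j : Fin n, (2 * δ) * ‖L (Matrix.single i j 1)‖ := by
        refine Finset.sum_le_sum fun i _ => Finset.sum_le_sum fun j _ =>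
          mul_le_mul_of_nonneg_right ?_ (norm_nonneg _)
        have h5 : δ / (P + 1) * P ≤ δ := by
          rw [div_mul_eq_mul_div, div_le_iff₀ (by positivity)]
          nlinarith
        have h6 := happ i j
        linarith
    _ = (2 * δ) * s := by simp only [hs, Finset.mul_sum]
    _ ≤ ε := by
        rw [hδ, mul_div_assoc', mul_div_mul_left _ _ two_ne_zero, div_mul_eq_mul_div,
          div_le_iff₀ (by positivity)]
        nlinarith

lemma exists_sector_of_eventually (hn : n ≠ 0) (m : ℕ) {P : ℂ → Prop}
    (hP : ∀ᶠ z in cobounded ℂ, P z) : ∃ ν₀ : Sector n m, ∀ ν, ν₀ < ν → P ν.1 := by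
  obtain ⟨r, -, hr⟩ := (Filter.hasBasis_cobounded_norm (E := ℂ)).eventually_iff.1 hP
  obtain ⟨z, hz, hzr⟩ := exists_mem_sector hn m (lt_of_lt_of_le one_pos (le_max_right r 1))
  refine ⟨⟨z, hz⟩, fun ν hν => hr ?_⟩
  have h1 : ‖z‖ < ‖ν.1‖ := hν
  exact ((le_max_left r 1).trans hzr.ge).trans h1.le

/-- The diagonal representation of a family of systems with the coefficients of the transformed
system, for an arbitrary linear realization `L` of the matrices by operators. -/
lemma exists_isDiagRepresentation {H : Type*} [NormedAddCommGroup H] [InnerProductSpace ℂ H]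
    [CompleteSpace H] (L : Matrix (Fin n) (Fin n) ℂ →ₗ[ℂ] (H →L[ℂ] H))
    {p p' : Fin n → ℝ → ℝ} {q : Fin n → Fin n → ℝ → ℂ} (hn0 : n ≠ 0)
    (hp : ∀ k, HasW11Deriv (p k) (p' k)) (hpos : ∀ k, ∀ t ∈ Icc (0 : ℝ) 1, 0 < p k t)
    (hq : ∀ k l, l ≤ k → IntegrableOn (q k l) (Icc 0 1)) (ζ : ℂ) {m : ℕ}
    {τ : Equiv.Perm (Fin n)}
    (hτ : ∀ z ∈ sector n m, ∀ k l, k < l → (z * (rootU (τ k) - rootU (τ l))).re ≤ 0)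
    {A : Sector n m → ℝ → H →L[ℂ] H}
    (hA : ∀ z, ∀ᵐ t, t ∈ Icc (0 : ℝ) 1 → A z t =
      L (Matrix.diagonal (Adiag p z.1 t) + leadPert p p' q ζ t + remPert p q ζ z.1 t)) :
    ∃ d h V, IsDiagRepresentation A
      (fun k => L (Matrix.diagonal fun l => if l = τ k then 1 else 0)) d h V := by
  obtain ⟨g', hg'⟩ := memW11_geomMean hp hpos
  have hgc := continuousOn_geomMean hp hpos
  have hgpos : ∀ t ∈ Icc (0 : ℝ) 1, 0 < geomMean p t := fun t ht =>
    geomMean_pos fun k => hpos k t ht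
  obtain ⟨t₀, ht₀, hmin⟩ := isCompact_Icc.exists_isMinOn (nonempty_Icc.2 zero_le_one) hgc
  -- The constant `c` normalizes the gaps between the diagonal entries.
  obtain ⟨c, hc0, hc⟩ : ∃ c : ℝ, 0 < c ∧ ∀ j k : Fin n, j ≠ k →
      c ≤ geomMean p t₀ * ‖rootU j - rootU k‖ := by
    have h : ∀ᶠ c : ℝ in 𝓝[>] 0, ∀ j k : Fin n, j ≠ k →
        c ≤ geomMean p t₀ * ‖rootU j - rootU k‖ := by
      refine eventually_all.2 fun j => eventually_all.2 fun k => ?_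
      by_cases hjk : j = k
      · exact Eventually.of_forall fun c h => absurd hjk h
      · have hpos : 0 < geomMean p t₀ * ‖rootU j - rootU k‖ :=
          mul_pos (hgpos t₀ ht₀) (norm_pos_iff.2 (sub_ne_zero.2 fun h => hjk (rootU_injective h)))
        filter_upwards [nhdsWithin_le_nhds (eventually_le_nhds hpos)] with c hc _ using hc
    obtain ⟨c, hc, hc0⟩ := (h.and self_mem_nhdsWithin).exists
    exact ⟨c, hc0, hc⟩
  have hcC : (c : ℂ) ≠ 0 := by exact_mod_cast hc0.ne'
  have hh : ∀ k, HasW11Deriv (fun t => (c : ℂ)⁻¹ * rootU (τ k) * geomMean p t)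
      (fun t => (c : ℂ)⁻¹ * rootU (τ k) * g' t) := fun k => hg'.const_mul _
  have hdh : ∀ (z : ℂ) k t, c * z * ((c : ℂ)⁻¹ * rootU (τ k) * geomMean p t) =
      Adiag p z t (τ k) := by
    intro z k t
    rw [Adiag]
    field_simp
  refine ⟨fun z => c * z.1,
    fun _ k t => (c : ℂ)⁻¹ * rootU (τ k) * geomMean p t,
    fun z t => L (leadPert p p' q ζ t + remPert p q ζ z.1 t), ?_⟩
  refine ⟨fun _ k => (hh k).continuousOn.integrableOn_Icc, fun z => ?_, fun z => ?_, fun R => ?_,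
    fun ε hε => ?_, fun ε hε => ?_, fun z => ?_, ?_⟩
  · exact integrableOn_map_matrix L fun i j => (integrableOn_leadPert hp hpos hq ζ i j).add
      (integrableOn_remPert hp hpos hq ζ z.1 i j)
  · refine (ae_restrict_iff' measurableSet_Icc).2 ?_
    filter_upwards [hA z] with t ht hmem
    simp only [ht hmem, hdh]
    rw [sum_smul_map_diagonal L τ (Adiag p z.1 t), add_assoc, map_add]
  · refine exists_sector_of_eventually hn0 m (P := fun z => R < ‖(c : ℂ) * z‖) ?_
    filter_upwards [tendsto_norm_cobounded_atTop.eventually_gt_atTop (R / c)] with z hz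
    rw [norm_mul, Complex.norm_real, Real.norm_eq_abs, abs_of_pos hc0, mul_comm]
    exact (div_lt_iff₀ hc0).1 hz
  · obtain ⟨z, hz, -⟩ := exists_mem_sector hn0 m one_pos
    refine ⟨⟨z, hz⟩, ∑ k, ∫ t in (0 : ℝ)..1, (‖(c : ℂ)⁻¹ * rootU (τ k) * geomMean p t‖ +
      ‖(c : ℂ)⁻¹ * rootU (τ k) * g' t‖), fun ν _ k => ⟨_, ⟨_, hh k, ?_⟩, by simpa using hε.le⟩⟩
    exact Finset.single_le_sum (f := fun k => ∫ t in (0 : ℝ)..1,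
      (‖(c : ℂ)⁻¹ * rootU (τ k) * geomMean p t‖ + ‖(c : ℂ)⁻¹ * rootU (τ k) * g' t‖))
      (fun k _ => intervalIntegral.integral_nonneg zero_le_one fun t _ => by positivity)
      (Finset.mem_univ k)
  · obtain ⟨C, C', hC, hC0, hC1, hev⟩ := exists_approx_pert L hn0 hp hpos hq ζ hε
    obtain ⟨ν₀, hν₀⟩ := exists_sector_of_eventually hn0 m hev
    exact ⟨ν₀, _, fun ν hν => ⟨C, memW11Ball_of_hasW11Deriv hC, hC0, hC1, hν₀ ν hν⟩⟩
  · refine (ae_restrict_iff' measurableSet_Icc).2 (Eventually.of_forall fun t ht k l hkl => ?_)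
    have h1 := hc (τ k) (τ l) fun h => hkl.ne (τ.injective h)
    have h2 : geomMean p t₀ ≤ geomMean p t := hmin ht
    rw [← sub_mul, ← mul_sub, norm_mul, norm_mul, norm_inv, Complex.norm_real, Complex.norm_real,
      Real.norm_eq_abs, Real.norm_eq_abs, abs_of_pos hc0, abs_of_pos (hgpos t ht), mul_assoc,
      inv_mul_eq_div, le_div_iff₀ hc0, one_mul, mul_comm]
    exact h1.trans (mul_le_mul_of_nonneg_right h2 (norm_nonneg _))
  · refine ⟨1 / 2, by norm_num, by norm_num, fun z a b ha hab hb k l hkl => ?_⟩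
    have hle : ∀ t ∈ Icc a b, 0 ≤ -(c * z.1 * ((c : ℂ)⁻¹ * rootU (τ k) * geomMean p t) -
        c * z.1 * ((c : ℂ)⁻¹ * rootU (τ l) * geomMean p t)).re := by
      intro t ht
      have h1 := hτ z.1 z.2 k l hkl
      have h2 := hgpos t ⟨ha.trans ht.1, ht.2.trans hb⟩
      rw [hdh, hdh, Adiag, Adiag, ← mul_sub, mul_right_comm, Complex.re_mul_ofReal]
      nlinarith
    have h3 := intervalIntegral.integral_nonneg (μ := volume) hab hle
    rw [intervalIntegral.integral_neg] at h3
    have h4 : 0 ≤ -Real.log (1 / 2) := by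
      rw [one_div, Real.log_inv, neg_neg]
      exact Real.log_nonneg (by norm_num)
    exact (neg_nonneg.1 h3).trans h4

/-- The transformed system satisfies the hypotheses of the diagonalization method in every
sector. -/
lemma satisfiesDiagConditions {p p' : Fin n → ℝ → ℝ} {q : Fin n → Fin n → ℝ → ℂ} (hn : 2 ≤ n)
    (hp : ∀ k, HasW11Deriv (p k) (p' k)) (hpos : ∀ k, ∀ t ∈ Icc (0 : ℝ) 1, 0 < p k t)
    (hq : ∀ k l, l ≤ k → IntegrableOn (q k l) (Icc 0 1)) (ζ : ℂ) (m : ℕ) :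
    ∃ τ : Equiv.Perm (Fin n), SatisfiesDiagConditions
      (fun (z : Sector n m) (t : ℝ) => transformed p q ζ z.1 t)
      (fun k => coordProj (τ k)) := by
  obtain ⟨τ, hτ⟩ := exists_perm_ordered (by omega : n ≠ 0) m
  refine ⟨τ, isCompleteProjSystem_coordProj τ, ?_⟩
  refine exists_isDiagRepresentation
    (Matrix.toEuclideanCLM (n := Fin n) (𝕜 := ℂ)).toAlgEquiv.toLinearMap
    (by omega) hp hpos hq ζ hτ fun z => ?_
  filter_upwards [ae_transformed_eq (q := q) hn hp hpos ζ] with t ht hmem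
  exact ht hmem z.1 (ne_zero_of_mem_sector z.2)

end Representation

/-! ### Asymptotics of the solutions -/

section Solutions

variable {n : ℕ}

/-- The transformed system, for large parameters of a sector, as an oscillating system: the common
diagonal terms `-(1/n) ∑ (q_aa + (log w_a)')` are left to the scalar factor of the solutions. -/
def transformedSystem {p p' : Fin n → ℝ → ℝ} {q : Fin n → Fin n → ℝ → ℂ} (hn : n ≠ 0)
    (hp : ∀ k, HasW11Deriv (p k) (p' k)) (hpos : ∀ k, ∀ t ∈ Icc (0 : ℝ) 1, 0 < p k t)
    (hq : ∀ k l, l ≤ k → IntegrableOn (q k l) (Icc 0 1)) (ζ : ℂ) (m : ℕ) :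
    OscillatingSystem n where
  U := {z | z ∈ sector n m ∧ 1 < ‖z‖}
  ω := rootU
  g := geomMean p
  ζ := ζ
  B j l t := if j = l then 0 else leadPert p p' q ζ t j l
  R z j l t := remPert p q ζ z t j l
  η := remSize n ζ
  ρ := remDom p q
  isOpen_U := (isOpen_sector n m).inter (isOpen_lt continuous_const continuous_norm)
  ω_injective := rootU_injective
  g_continuousOn := continuousOn_geomMean hp hpos
  g_pos t ht := geomMean_pos fun k => hpos k t ht
  B_integrable j l := by
    split_ifs
    · exact integrable_zero _ _ _
    · exact integrableOn_leadPert hp hpos hq ζ j l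
  B_diag j := by funext t; simp
  R_integrable z _ j l := integrableOn_remPert hp hpos hq ζ z j l
  R_le z hz j l t _ := norm_remPert_le p q ζ hz.2.le t j l
  R_differentiableOn j l t _ z hz :=
    (differentiableAt_remPert p q ζ (ne_zero_of_mem_sector hz.1) t j l).differentiableWithinAt
  ρ_nonneg := remDom_nonneg p q
  ρ_integrable := integrableOn_remDom hp hpos hq
  η_tendsto := tendsto_remSize hn ζ
  sign j k := (sector_sign (m := m) j k).imp (fun h z hz => h z hz.1) (fun h z hz => h z hz.1)

/-- The product of powers in front of the exponential in `mainFactor` is `(∏ w_a)^{-1/n}`, where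
`w_a` are the weights; here in terms of logarithms. -/
lemma sum_logWeight (hn : n ≠ 0) (p : Fin n → ℝ → ℝ) (t : ℝ) :
    ∑ l : Fin n, Real.log (p l t) * (((n : ℝ) - 2 * ((l.val : ℝ) + 1) + 1) / (2 * n)) =
      -(n : ℝ)⁻¹ * ∑ a, logWeight p a t := by
  have hn' : (n : ℝ) ≠ 0 := Nat.cast_ne_zero.2 hn
  have hgauss : ∑ a : Fin n, (a.val : ℝ) = n * ((n : ℝ) - 1) / 2 := by
    rw [Fin.sum_univ_eq_sum_range fun i => (i : ℝ)]
    have h := Finset.sum_range_id_mul_two n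
    have h2 : (∑ i ∈ Finset.range n, (i : ℝ)) * 2 = n * ((n - 1 : ℕ) : ℝ) := by
      rw [← Nat.cast_mul, ← h, Nat.cast_mul, Nat.cast_sum, Nat.cast_ofNat]
    rw [Nat.cast_pred (Nat.pos_of_ne_zero hn)] at h2
    linarith
  have hcount : ∑ a : Fin n, ∑ m with m < a, Real.log (p m t) =
      ∑ m : Fin n, ((n : ℝ) - 1 - m.val) * Real.log (p m t) := by
    simp only [Finset.sum_filter]
    rw [Finset.sum_comm]
    refine Finset.sum_congr rfl fun m _ => ?_
    rw [← Finset.sum_filter, Finset.sum_const, nsmul_eq_mul, Finset.filter_lt_eq_Ioi, Fin.card_Ioi]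
    have := m.2
    rw [Nat.cast_sub (by omega), Nat.cast_pred (by omega)]
  simp only [logWeight]
  rw [Finset.sum_sub_distrib, ← Finset.sum_mul, hgauss, hcount, mul_sub, Finset.mul_sum,
    Finset.sum_div, Finset.mul_sum, Finset.mul_sum, ← Finset.sum_sub_distrib]
  refine Finset.sum_congr rfl fun l _ => ?_
  field_simp
  ring

/-- The logarithmic derivative of the scalar factor of the `k`-th solution. -/
def mainRate (p p' : Fin n → ℝ → ℝ) (q : Fin n → Fin n → ℝ → ℂ) (ζ z : ℂ) (k : Fin n) (t : ℝ) : ℂ :=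
  -(n : ℂ)⁻¹ * ∑ a, (logWeightDeriv p p' a t : ℂ) +
    ((z + ζ) * geomMean p t * rootU k - 1 / (n : ℂ) * ∑ l, q l l t)

lemma integrableOn_exponent {p p' : Fin n → ℝ → ℝ} {q : Fin n → Fin n → ℝ → ℂ}
    (hp : ∀ k, HasW11Deriv (p k) (p' k)) (hpos : ∀ k, ∀ t ∈ Icc (0 : ℝ) 1, 0 < p k t)
    (hq : ∀ k l, l ≤ k → IntegrableOn (q k l) (Icc 0 1)) (ζ z : ℂ) (k : Fin n) :
    IntegrableOn (fun t => (z + ζ) * geomMean p t * rootU k - 1 / (n : ℂ) * ∑ l, q l l t)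
      (Icc 0 1) :=
  (((integrableOn_geomMean hp hpos).const_mul _).mul_const _).sub
    ((integrable_finsetSum _ fun l _ => hq l l le_rfl).const_mul _)

lemma hasW11Deriv_mainFactor {p p' : Fin n → ℝ → ℝ} {q : Fin n → Fin n → ℝ → ℂ} (hn : n ≠ 0)
    (hp : ∀ k, HasW11Deriv (p k) (p' k)) (hpos : ∀ k, ∀ t ∈ Icc (0 : ℝ) 1, 0 < p k t)
    (hq : ∀ k l, l ≤ k → IntegrableOn (q k l) (Icc 0 1)) (ζ z : ℂ) (k : Fin n) :
    HasW11Deriv (mainFactor p q ζ z k)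
      (fun t => mainFactor p q ζ z k t * mainRate p p' q ζ z k t) := by
  have h1 := (HasW11Deriv.sum Finset.univ fun a _ =>
    (hasW11Deriv_logWeight hp hpos a).ofReal).const_mul (-(n : ℂ)⁻¹)
  have h2 := HasW11Deriv.primitive (integrableOn_exponent hp hpos hq ζ z k)
    (left_mem_Icc.2 zero_le_one)
  have heq : ∀ t ∈ Icc (0 : ℝ) 1, Complex.exp (-(n : ℂ)⁻¹ * ∑ a, (logWeight p a t : ℂ) +
      ∫ s in (0 : ℝ)..t, ((z + ζ) * geomMean p s * rootU k - 1 / (n : ℂ) * ∑ l, q l l s)) =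
        mainFactor p q ζ z k t := by
    intro t ht
    have h3 : ∏ l : Fin n, p l t ^ (((n : ℝ) - 2 * ((l.val : ℝ) + 1) + 1) / (2 * n)) =
        Real.exp (-(n : ℝ)⁻¹ * ∑ a, logWeight p a t) := by
      rw [← sum_logWeight hn, Real.exp_sum]
      exact Finset.prod_congr rfl fun l _ => Real.rpow_def_of_pos (hpos l t ht) _
    rw [mainFactor, h3, Complex.exp_add]
    push_cast
    rfl
  refine (h1.add h2).cexp.congr heq (Eventually.of_forall fun t ht => ?_)
  rw [heq t ht, mainRate]

lemma differentiable_mainFactor {p p' : Fin n → ℝ → ℝ} {q : Fin n → Fin n → ℝ → ℂ}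
    (hp : ∀ k, HasW11Deriv (p k) (p' k)) (hpos : ∀ k, ∀ t ∈ Icc (0 : ℝ) 1, 0 < p k t)
    (hq : ∀ k l, l ≤ k → IntegrableOn (q k l) (Icc 0 1)) (ζ : ℂ) (k : Fin n) {t : ℝ}
    (ht : t ∈ Icc (0 : ℝ) 1) : Differentiable ℂ (fun z => mainFactor p q ζ z k t) := by
  have h : ∀ z : ℂ, ∫ s in (0 : ℝ)..t,
      ((z + ζ) * geomMean p s * rootU k - 1 / (n : ℂ) * ∑ l, q l l s) =
      (z + ζ) * (∫ s in (0 : ℝ)..t, (geomMean p s : ℂ)) * rootU k -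
        1 / (n : ℂ) * ∫ s in (0 : ℝ)..t, ∑ l, q l l s := by
    intro z
    rw [intervalIntegral.integral_sub
      ((((intervalIntegrable_of_integrableOn_Icc (integrableOn_geomMean hp hpos)
        (left_mem_Icc.2 zero_le_one) ht)).const_mul _).mul_const _)
      ((intervalIntegrable_of_integrableOn_Icc (integrable_finsetSum _ fun l _ => hq l l le_rfl)
        (left_mem_Icc.2 zero_le_one) ht).const_mul _),
      intervalIntegral.integral_mul_const, intervalIntegral.integral_const_mul,
      intervalIntegral.integral_const_mul]
  unfold mainFactor
  simp only [h]
  fun_prop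

lemma hasW11Deriv_euclidean {f f' : ℝ → EuclideanSpace ℂ (Fin n)}
    (h : ∀ j, HasW11Deriv (fun t => f t j) (fun t => f' t j)) : HasW11Deriv f f' := by
  have hx : ∀ x : EuclideanSpace ℂ (Fin n), ∑ j, x j • EuclideanSpace.single j (1 : ℂ) = x := by
    intro x
    ext i
    simp [Pi.single_apply]
  refine (HasW11Deriv.sum Finset.univ fun j _ => (h j).clm_comp
    ((ContinuousLinearMap.toSpanSingleton ℂ
      (EuclideanSpace.single j (1 : ℂ))).restrictScalars ℝ)).congr
    (fun t _ => hx (f t)) (Eventually.of_forall fun t _ => hx (f' t))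

lemma norm_euclidean_le_sum (x : EuclideanSpace ℂ (Fin n)) : ‖x‖ ≤ ∑ j, ‖x j‖ := by
  have hx : ∑ j, EuclideanSpace.single j (x j) = x := by
    ext i
    simp
  conv_lhs => rw [← hx]
  exact norm_sum_le_of_le _ fun j _ => by simp

/-- The product of the scalar factor and the amplitudes solves the transformed system. -/
lemma hasW11Deriv_solution {p p' : Fin n → ℝ → ℝ} {q : Fin n → Fin n → ℝ → ℂ} (hn : 2 ≤ n)
    (hp : ∀ k, HasW11Deriv (p k) (p' k)) (hpos : ∀ k, ∀ t ∈ Icc (0 : ℝ) 1, 0 < p k t)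
    (hq : ∀ k l, l ≤ k → IntegrableOn (q k l) (Icc 0 1)) {ζ z : ℂ} (hz : z ≠ 0) {k : Fin n}
    {u : Fin n → ℝ → ℂ}
    (hu : ∀ j, HasW11Deriv (u j) (fun t => (z + ζ) * (rootU j - rootU k) * geomMean p t * u j t +
      ∑ l, ((if j = l then 0 else leadPert p p' q ζ t j l) + remPert p q ζ z t j l) * u l t)) :
    HasW11Deriv (fun t => WithLp.toLp 2 fun j => mainFactor p q ζ z k t * u j t)
      (fun t => transformed p q ζ z t
        (WithLp.toLp 2 fun j => mainFactor p q ζ z k t * u j t)) := by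
  refine hasW11Deriv_euclidean fun j => ?_
  refine ((hasW11Deriv_mainFactor (by omega) hp hpos hq ζ z k).mul (hu j)).congr
    (fun _ _ => rfl) ?_
  filter_upwards [ae_transformed_eq (q := q) hn hp hpos ζ] with t ht hmem
  rw [ht hmem z hz]
  change _ = (Matrix.diagonal (Adiag p z t) + leadPert p p' q ζ t + remPert p q ζ z t).mulVec
    (fun j => mainFactor p q ζ z k t * u j t) j
  have hsplit : ∀ l, (Matrix.diagonal (Adiag p z t) + leadPert p p' q ζ t +
      remPert p q ζ z t) j l * (mainFactor p q ζ z k t * u l t) =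
      mainFactor p q ζ z k t *
        (((if j = l then 0 else leadPert p p' q ζ t j l) + remPert p q ζ z t j l) * u l t) +
      if j = l then mainFactor p q ζ z k t *
        ((Adiag p z t j + leadPert p p' q ζ t j j) * u j t) else 0 := by
    intro l
    rw [Matrix.add_apply, Matrix.add_apply, Matrix.diagonal_apply]
    split_ifs with h
    · subst h; ring
    · ring
  have hmv : (Matrix.diagonal (Adiag p z t) + leadPert p p' q ζ t + remPert p q ζ z t).mulVec
      (fun j => mainFactor p q ζ z k t * u j t) j =
      mainFactor p q ζ z k t * ∑ l,
        (((if j = l then 0 else leadPert p p' q ζ t j l) + remPert p q ζ z t j l) * u l t) +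
      mainFactor p q ζ z k t * ((Adiag p z t j + leadPert p p' q ζ t j j) * u j t) := by
    rw [Matrix.mulVec, dotProduct, Finset.sum_congr rfl fun l _ => hsplit l,
      Finset.sum_add_distrib, ← Finset.mul_sum, Finset.sum_ite_eq, if_pos (Finset.mem_univ j)]
  rw [hmv, leadPert_diag, mainRate, Adiag, Finset.sum_add_distrib]
  ring

end Solutions

end DiagMethod

end

theorem mainTheorem7 (n : ℕ) (hn : 2 ≤ n) (p : Fin n → ℝ → ℝ) (q : Fin n → Fin n → ℝ → ℂ) (ζ : ℂ)
    (hp : ∀ k, DiagMethod.MemW11 (p k))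
    (hpos : ∀ k, ∀ t ∈ Set.Icc (0 : ℝ) 1, 0 < p k t)
    (hq : ∀ k l, l ≤ k → MeasureTheory.IntegrableOn (q k l) (Set.Icc 0 1)) :
    (∀ z : ℂ, z ≠ 0 → ∀ t ∈ Set.Icc (0 : ℝ) 1,
      IsUnit (DiagMethod.Smat p z t) ∧
      (DiagMethod.Smat p z t)⁻¹ * DiagMethod.Dmat0 p z t * DiagMethod.Smat p z t
        = Matrix.diagonal (DiagMethod.Adiag p z t)) ∧
    ∀ m : ℕ, 1 ≤ m → m ≤ 2 * n →
      (∃ τ : Equiv.Perm (Fin n),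
        DiagMethod.SatisfiesDiagConditions
          (fun (z : DiagMethod.Sector n m) (t : ℝ) => DiagMethod.transformed p q ζ z.1 t)
          (fun k => DiagMethod.coordProj (τ k))) ∧
      ∃ R : ℝ, 0 < R ∧ ∀ k : Fin n, ∃ y : ℂ → ℝ → EuclideanSpace ℂ (Fin n),
        (∀ z ∈ DiagMethod.sector n m, R < ‖z‖ →
          DiagMethod.HasW11Deriv (y z) (fun t => DiagMethod.transformed p q ζ z t (y z t))) ∧
        (∀ t ∈ Set.Icc (0 : ℝ) 1,
          AnalyticOnNhd ℂ (fun z => y z t) {z | z ∈ DiagMethod.sector n m ∧ R < ‖z‖}) ∧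
        ∃ r : ℂ → ℝ → EuclideanSpace ℂ (Fin n),
          (∀ z ∈ DiagMethod.sector n m, R < ‖z‖ → ∀ t ∈ Set.Icc (0 : ℝ) 1,
            y z t = DiagMethod.mainFactor p q ζ z k t •
              (EuclideanSpace.single k (1 : ℂ) + r z t)) ∧
          ∀ ε : ℝ, 0 < ε → ∃ R' : ℝ, R ≤ R' ∧ ∀ z ∈ DiagMethod.sector n m, R' < ‖z‖ →
            ∀ t ∈ Set.Icc (0 : ℝ) 1, ‖r z t‖ < ε := by
  choose p' hp' using hp
  have hn0 : n ≠ 0 := by omega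
  refine ⟨fun z hz t ht => ⟨DiagMethod.isUnit_Smat (fun k => hpos k t ht) hz,
    DiagMethod.Smat_conj_Dmat0 hn0 (fun k => hpos k t ht) hz⟩, fun m _ _ =>
    ⟨DiagMethod.satisfiesDiagConditions hn hp' hpos hq ζ m, ?_⟩⟩
  let S := DiagMethod.transformedSystem hn0 hp' hpos hq ζ m
  obtain ⟨R₀, hR₀, hsol, hdiff, hlim⟩ := S.exists_amplitude
  have hU : ∀ z ∈ DiagMethod.sector n m, max R₀ 1 < ‖z‖ → z ∈ S.U ∧ R₀ < ‖z‖ := fun z hz hzR =>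
    ⟨⟨hz, (le_max_right _ _).trans_lt hzR⟩, (le_max_left _ _).trans_lt hzR⟩
  refine ⟨max R₀ 1, lt_max_of_lt_left hR₀, fun k => ⟨fun z t => WithLp.toLp 2 fun j =>
    DiagMethod.mainFactor p q ζ z k t * S.amplitude z k j t, fun z hz hzR => ?_, fun t ht => ?_,
    fun z t => WithLp.toLp 2 fun j => S.amplitude z k j t - if j = k then 1 else 0,
    fun z _ _ t _ => ?_, fun ε hε => ?_⟩⟩
  · exact DiagMethod.hasW11Deriv_solution hn hp' hpos hq (DiagMethod.ne_zero_of_mem_sector hz)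
      fun j => hsol z (hU z hz hzR).1 (hU z hz hzR).2 k j
  · refine DifferentiableOn.analyticOnNhd (differentiableOn_euclidean.2 fun j => ?_)
      ((DiagMethod.isOpen_sector n m).inter (isOpen_lt continuous_const continuous_norm))
    exact (DiagMethod.differentiable_mainFactor hp' hpos hq ζ k ht).differentiableOn.mul
      ((hdiff k j t ht).mono fun z hz => hU z hz.1 hz.2)
  · ext j
    simp
    split_ifs <;> ring
  · obtain ⟨R', hR', hsmall⟩ := hlim (ε / (n + 1)) (by positivity)
    refine ⟨max R' (max R₀ 1), le_max_right _ _, fun z hz hzR t ht => ?_⟩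
    have hzU := hU z hz ((le_max_right _ _).trans_lt hzR)
    refine (DiagMethod.norm_euclidean_le_sum _).trans_lt ?_
    calc ∑ j, ‖S.amplitude z k j t - if j = k then 1 else 0‖
        ≤ ∑ _j : Fin n, ε / (n + 1) := Finset.sum_le_sum fun j _ =>
          (hsmall z hzU.1 ((le_max_left _ _).trans_lt hzR) k j t ht).le
      _ = n * (ε / (n + 1)) := by simp
      _ < ε := by
        rw [mul_div_assoc', div_lt_iff₀ (by positivity)]
        nlinarith
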